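/- For $u=(u_n)_{n\in\mathbb Z}$, $u_n=(Q_n,R_n)^T\in\mathbb C^2$, put $\gamma_n^2=1-Q_nR_n$, and let $\mathcal P$ be the set of those $u$ which decrease faster than every power of $|n|$ as $|n|\to\infty$ and satisfy $\gamma_n^2\neq0$ for all $n$. Let $Ef(n)=f(n+1)$, and let $(E-1)^{-1}$ denote the summation operator $$\big((E-1)^{-1}f\big)(n)=\theta\sum_{k<n}f(k)-(1-\theta)\sum_{k\ge n}f(k),$$ where $\theta\in\mathbb C$ is an arbitrary fixed number ($\theta=1$: summation from the left, $\theta=0$: from the right, $\theta=\tfrac12$: the skew-symmetric choice). For $u\in\mathcal P$ define operators on rapidly decreasing $\mathbb C^2$-valued sequences by $$L=\begin{pmatrix}E&0\\0&E^{-1}\end{pmatrix}+\begin{pmatrix}-Q_nE\\R_n\end{pmatrix}(E-1)^{-1}(R_nE,\;Q_nE^{-1})+\gamma_n^2\begin{pmatrix}-EQ_n\\R_{n-1}\end{pmatrix}(E-1)^{-1}(R_n,\;Q_n)\frac1{\gamma_n^2},$$ $$L^{-1}=\begin{pmatrix}E^{-1}&0\\0&E\end{pmatrix}+\begin{pmatrix}Q_n\\-R_nE\end{pmatrix}(E-1)^{-1}(R_nE^{-1},\;Q_nE)+\gamma_n^2\begin{pmatrix}Q_{n-1}\\-ER_n\end{pmatrix}(E-1)^{-1}(R_n,\;Q_n)\frac1{\gamma_n^2},$$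 and $\mathcal L=L-2I+L^{-1}$. Let $K^{(0)}=(Q_n,-R_n)^T$, $\sigma^{(0)}=(2n+1)(Q_n,-R_n)^T$, $$K^{(0)}_{[0]}=K^{(0)},\quad K^{(0)}_{[1]}=\tfrac12(L-L^{-1})K^{(0)},\quad \sigma^{(0)}_{[0]}=\tfrac12\sigma^{(0)},\quad \sigma^{(0)}_{[1]}=\tfrac14(L-L^{-1})\sigma^{(0)},$$ and, for $j\in\{0,1\}$ and integers $m,s\ge0$, $K^{(m)}_{[j]}=\mathcal L^mK^{(0)}_{[j]}$ and $\sigma^{(s)}_{[j]}=\mathcal L^s\sigma^{(0)}_{[j]}$, regarded as vector functions of $u\in\mathcal P$. For such functions let $f'[g](u)=\frac{d}{d\epsilon}\big|_{\epsilon=0}f(u+\epsilon g(u))$ ($\epsilon\in\mathbb R$, derivative taken at each lattice site) be the Gateaux derivative and $[f,g]=f'[g]-g'[f]$. Then the operators $L$ and $L^{-1}$ map rapidly decreasing sequences to rapidly decreasing sequences and are inverse to each other there; all the flows have rapidly decreasing values; and the complex linear span $\mathcal D$ of all the flows $K^{(m)}_{[j]}$, $\sigma^{(s)}_{[j]}$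 is a Lie algebra under $[\cdot,\cdot]$: the Gateaux derivatives involved exist, $\mathcal D$ is closed under the bracket, and the bracket is $\mathbb C$-bilinear, alternating and satisfies the Jacobi identity on $\mathcal D$. Moreover, for all $j,k\in\{0,1\}$ and $m,s\ge0$, $$\begin{aligned} [K^{(m)}_{[j]},K^{(s)}_{[k]}]&=0,\\ [K^{(m)}_{[0]},\sigma^{(s)}_{[0]}]&=2m\,K^{(m+s-1)}_{[1]},\\ [K^{(m)}_{[0]},\sigma^{(s)}_{[1]}]&=\tfrac12m\big(K^{(m+s+1)}_{[0]}+4K^{(m+s)}_{[0]}\big),\\ [K^{(m)}_{[1]},\sigma^{(s)}_{[j]}]&=\tfrac12\big[(m+1)K^{(m+s+1)}_{[j]}+2(2m+1)K^{(m+s)}_{[j]}\big],\\ [\sigma^{(m)}_{[0]},\sigma^{(s)}_{[0]}]&=2(m-s)\,\sigma^{(m+s-1)}_{[1]},\\ [\sigma^{(m)}_{[j]},\sigma^{(s)}_{[1]}]&=\tfrac12\big[(m-s-1+j)\sigma^{(m+s+1)}_{[j]}+2(2m-2s-1+j)\sigma^{(m+s)}_{[j]}\big], \end{aligned}$$ where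 $K^{(-1)}_{[j]}=\sigma^{(-1)}_{[j]}=0$. -/

import Mathlib

namespace DAKNS

noncomputable section

/-- Pairs of complex lattice functions: `(u n).1 = Q_n` and `(u n).2 = R_n`. -/
abbrev Vec : Type := ℤ → ℂ × ℂ

/-- `u_n` tends to zero, as `|n| → ∞`, faster than every power of `n`. -/
def RapidDecay (u : Vec) : Prop :=
  ∀ k : ℕ, ∃ C : ℝ, ∀ n : ℤ, |(n : ℝ)| ^ k * ‖u n‖ ≤ C

/-- The phase space: rapidly decreasing potentials `u_n = (Q_n, R_n)` for which
`γ_n² = 1 - Q_n R_n` never vanishes. -/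
def Phase : Type :=
  {u : Vec // RapidDecay u ∧ ∀ n : ℤ, 1 - (u n).1 * (u n).2 ≠ 0}

/-- A vector function `f(u_n)` of the potential. -/
abbrev VectorField : Type := Phase → Vec

/-- `γ_n² = 1 - Q_n R_n`. -/
def gammaSq (u : Vec) (n : ℤ) : ℂ := 1 - (u n).1 * (u n).2

/-- The inverse `(E - 1)⁻¹` of the difference operator:
`θ ∑_{k < n} f(k) - (1 - θ) ∑_{k ≥ n} f(k)`.
The values `θ = 1`, `θ = 0`, `θ = 1/2` give the summation from the left, the one from the right,
and the skew-symmetric one. On rapidly decreasing functions these are exactly the linear right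
inverses of `E - 1` that commute with the shift `E`. -/
def invDiff (θ : ℂ) (f : ℤ → ℂ) (n : ℤ) : ℂ :=
  θ * (∑' k : ℕ, f (n - 1 - (k : ℤ))) - (1 - θ) * (∑' k : ℕ, f (n + (k : ℤ)))

/-- `(E - 1)⁻¹ (R_n, Q_n) γ_n⁻² h`. -/
def nonlocalGamma (θ : ℂ) (u h : Vec) : ℤ → ℂ :=
  invDiff θ fun n => ((u n).2 * (h n).1 + (u n).1 * (h n).2) / gammaSq u n

/-- The recursion operator `L` at the potential `u`, applied to `h`. -/
def opL (θ : ℂ) (u h : Vec) : Vec :=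
  let s : ℤ → ℂ := invDiff θ fun n => (u n).2 * (h (n + 1)).1 + (u n).1 * (h (n - 1)).2
  let t : ℤ → ℂ := nonlocalGamma θ u h
  fun n =>
    ((h (n + 1)).1 - (u n).1 * s (n + 1) - gammaSq u n * ((u (n + 1)).1 * t (n + 1)),
     (h (n - 1)).2 + (u n).2 * s n + gammaSq u n * ((u (n - 1)).2 * t n))

/-- The operator `L⁻¹` at the potential `u`, applied to `h`. -/
def opLInv (θ : ℂ) (u h : Vec) : Vec :=
  let s : ℤ → ℂ := invDiff θ fun n => (u n).2 * (h (n - 1)).1 + (u n).1 * (h (n + 1)).2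
  let t : ℤ → ℂ := nonlocalGamma θ u h
  fun n =>
    ((h (n - 1)).1 + (u n).1 * s n + gammaSq u n * ((u (n - 1)).1 * t n),
     (h (n + 1)).2 - (u n).2 * s (n + 1) - gammaSq u n * ((u (n + 1)).2 * t (n + 1)))

/-- `𝓛 = L - 2 I + L⁻¹`. -/
def opCalL (θ : ℂ) (u h : Vec) : Vec :=
  opL θ u h - (2 : ℂ) • h + opLInv θ u h

/-- The Ablowitz-Ladik flow `K⁽⁰⁾ = (Q_n, -R_n)ᵀ`. -/
def alK (u : Vec) : Vec := fun n => ((u n).1, -(u n).2)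

/-- The Ablowitz-Ladik flow `σ⁽⁰⁾ = (2n+1) (Q_n, -R_n)ᵀ`. -/
def alSigma (u : Vec) : Vec := fun n => (2 * (n : ℂ) + 1) • alK u n

/-- `K⁽⁰⁾_[0] = K⁽⁰⁾` and `K⁽⁰⁾_[1] = (1/2) (L - L⁻¹) K⁽⁰⁾`. -/
def K0 (θ : ℂ) (j : Fin 2) (u : Vec) : Vec :=
  if j = 0 then alK u
  else (1 / 2 : ℂ) • (opL θ u (alK u) - opLInv θ u (alK u))

/-- `σ⁽⁰⁾_[0] = (1/2) σ⁽⁰⁾` and `σ⁽⁰⁾_[1] = (1/4) (L - L⁻¹) σ⁽⁰⁾`. -/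
def sigma0 (θ : ℂ) (j : Fin 2) (u : Vec) : Vec :=
  if j = 0 then (1 / 2 : ℂ) • alSigma u
  else (1 / 4 : ℂ) • (opL θ u (alSigma u) - opLInv θ u (alSigma u))

/-- The isospectral flow `K⁽ᵐ⁾_[j] = 𝓛ᵐ K⁽⁰⁾_[j]`. -/
def K (θ : ℂ) (j : Fin 2) (m : ℕ) : VectorField :=
  fun u => (opCalL θ u.1)^[m] (K0 θ j u.1)

/-- The non-isospectral flow `σ⁽ˢ⁾_[j] = 𝓛ˢ σ⁽⁰⁾_[j]`. -/
def sigma (θ : ℂ) (j : Fin 2) (s : ℕ) : VectorField :=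
  fun u => (opCalL θ u.1)^[s] (sigma0 θ j u.1)

/-- `prev F l = F⁽ˡ⁻¹⁾`, with the convention `F⁽⁻¹⁾ = 0`. -/
def prev (F : ℕ → VectorField) : ℕ → VectorField
  | 0 => 0
  | l + 1 => F l

/-- The curve `ε ↦ f(u + ε v)_n`; it matters for small real `ε` only, and the value `0` is used
where `u + ε v` leaves the phase space. -/
def alongLine (f : VectorField) (u : Phase) (v : Vec) (n : ℤ) (ε : ℝ) : ℂ × ℂ :=
  Function.extend Subtype.val f 0 (u.1 + ε • v) n

/-- The Gateaux derivative `f'[g]`, that is `d/dε f(u + ε g(u))` at `ε = 0`. -/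
def gateaux (f g : VectorField) : VectorField :=
  fun u n => deriv (alongLine f u (g u) n) 0

/-- The Lie product `⟦f, g⟧ = f'[g] - g'[f]`. -/
def bracket (f g : VectorField) : VectorField := gateaux f g - gateaux g f

/-- The linear span `𝒟` of all the flows `K⁽ᵐ⁾_[j]` and `σ⁽ˢ⁾_[j]`. -/
def algD (θ : ℂ) : Submodule ℂ VectorField :=
  Submodule.span ℂ
    ({f | ∃ (j : Fin 2) (m : ℕ), f = K θ j m} ∪ {f | ∃ (j : Fin 2) (s : ℕ), f = sigma θ j s})

end

end DAKNS

/-! The recursion operator is encoded by a discrete zero curvature relation: `w = L h` means that a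
matrix `N`, polynomial in the spectral parameter, satisfies `(E N) U - U N = U'[w] - z² U'[h]`
(`LaxData`). The diagonal entries of `N` are the only nonlocal ones. They are fixed by the
requirement that `(E - 1)⁻¹` reproduces them from their differences (`Normalized`); such a function
vanishes once its differences vanish (`Normalized.eq_zero`). This replaces every discussion of
summation constants, so a single argument serves all `θ`.

From this encoding come the linearity of `L`, the identity `L⁻¹ L = 1` and, by interchanging `Q` and
`R`, `L L⁻¹ = 1` (`recOp`). It also shows that `L` is hereditary: differentiating the relation for
`X` and `Y` and comparing powers of `z` makes the Nijenhuis torsion vanish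
(`LaxData.torsion_eq_zero`, `recOpDer_torsion`).

Heredity turns the bracket into algebra. Write `lieOp F` for minus the Lie derivative of `L` along
`F`. Then `lieOp (L F) = L ∘ lieOp F` and `[F, L G] = lieOp F G + L [F, G]`. The two seeds `K⁽⁰⁾`
and `σ⁽⁰⁾` commute and are infinitesimal gauge transformations, with `lieOp` equal to `0` and `-2 L`
respectively (`lieOp_seed`). With `δ = T d/dT` this gives, for Laurent polynomials `p`, `q`, `[p(L)
K, q(L) K] = 0`, `[p(L) K, q(L) σ] = 2 (δp q)(L) K`, `[p(L) σ, q(L) σ] = 2 (δp q - p δq)(L) σ`. The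
flows have as symbols products of `W = T - 2 + T⁻¹`, `V = T - T⁻¹` and constants. All structure
relations follow from `δW = V`, `δV = W + 2`, `V² = W² + 4 W`. The Jacobi identity is the one for
these symbols, so no second Gateaux derivative is needed.

The analysis consists of first order expansions in `ε` with `O(ε²)` remainders, uniform over the
lattice in every weight `(1 + |n|)^k` (`Jet`, `VecJet`). Uniformity lets differentiation pass
through the infinite sums and keeps `u + ε v` in the phase space for small `ε`. -/

namespace DAKNS

noncomputable section

section

open Filter Topology

/-! ### Weighted bounds for families of lattice functions -/

/-- The weight `1 + |n|`. -/
def weight (n : ℤ) : ℝ := 1 + |(n : ℝ)|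

lemma one_le_weight (n : ℤ) : 1 ≤ weight n := by
  unfold weight; linarith [abs_nonneg (n : ℝ)]

lemma weight_pos (n : ℤ) : 0 < weight n := lt_of_lt_of_le one_pos (one_le_weight n)

/-- Triangle inequality; it makes weighted bounds stable under shifts, at the cost of a constant
depending on the shift only. -/
lemma weight_le_mul (n m : ℤ) : weight n ≤ weight m * weight (n + m) := by
  unfold weight
  have h : |(n : ℝ)| ≤ |(m : ℝ)| + |((n + m : ℤ) : ℝ)| := by
    have := abs_sub ((n + m : ℤ) : ℝ) (m : ℝ)
    push_cast at this ⊢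
    rw [add_sub_cancel_right] at this
    linarith
  nlinarith [mul_nonneg (abs_nonneg (m : ℝ)) (abs_nonneg ((n + m : ℤ) : ℝ))]

/-- The family `c ε` is `O(|ε|^p)` as `ε → 0`, uniformly with respect to `(1 + |n|)^k`. -/
def IsBig (k p : ℕ) (c : ℝ → ℤ → ℂ) : Prop :=
  ∃ C : ℝ, 0 ≤ C ∧ ∀ᶠ ε in 𝓝 (0 : ℝ), ∀ n, weight n ^ k * ‖c ε n‖ ≤ C * |ε| ^ p

namespace IsBig

variable {k l p q : ℕ} {c d : ℝ → ℤ → ℂ}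

lemma congr (h : IsBig k p c) (hcd : ∀ᶠ ε in 𝓝 (0 : ℝ), c ε = d ε) : IsBig k p d := by
  obtain ⟨C, hC, h⟩ := h
  refine ⟨C, hC, ?_⟩
  filter_upwards [h, hcd] with ε h1 h2
  rwa [← h2]

lemma add (hc : IsBig k p c) (hd : IsBig k p d) : IsBig k p fun ε n => c ε n + d ε n := by
  obtain ⟨C, hC, hc⟩ := hc
  obtain ⟨D, hD, hd⟩ := hd
  refine ⟨C + D, add_nonneg hC hD, ?_⟩
  filter_upwards [hc, hd] with ε h1 h2 n
  calc weight n ^ k * ‖c ε n + d ε n‖ ≤ weight n ^ k * (‖c ε n‖ + ‖d ε n‖) := by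
        have := weight_pos n
        gcongr
        exact norm_add_le _ _
    _ ≤ (C + D) * |ε| ^ p := by linarith [h1 n, h2 n]

lemma neg (hc : IsBig k p c) : IsBig k p fun ε n => -c ε n := by
  simpa [IsBig] using hc

lemma sub (hc : IsBig k p c) (hd : IsBig k p d) : IsBig k p fun ε n => c ε n - d ε n := by
  simpa [sub_eq_add_neg] using hc.add hd.neg

lemma mul (hc : IsBig k p c) (hd : IsBig l q d) :
    IsBig (k + l) (p + q) fun ε n => c ε n * d ε n := by
  obtain ⟨C, hC, hc⟩ := hc
  obtain ⟨D, hD, hd⟩ := hd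
  refine ⟨C * D, mul_nonneg hC hD, ?_⟩
  filter_upwards [hc, hd] with ε h1 h2 n
  have := weight_pos n
  calc weight n ^ (k + l) * ‖c ε n * d ε n‖
      = (weight n ^ k * ‖c ε n‖) * (weight n ^ l * ‖d ε n‖) := by rw [norm_mul]; ring
    _ ≤ (C * |ε| ^ p) * (D * |ε| ^ q) :=
        mul_le_mul (h1 n) (h2 n) (by positivity) (by positivity)
    _ = C * D * |ε| ^ (p + q) := by ring

lemma mono (hc : IsBig k p c) (hl : l ≤ k) (hq : q ≤ p) : IsBig l q c := by
  obtain ⟨C, hC, hc⟩ := hc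
  refine ⟨C, hC, ?_⟩
  have h1 : ∀ᶠ ε in 𝓝 (0 : ℝ), |ε| < 1 := by
    have := Metric.ball_mem_nhds (0 : ℝ) one_pos
    filter_upwards [this] with ε hε
    simpa using hε
  filter_upwards [hc, h1] with ε h1 h2 n
  calc weight n ^ l * ‖c ε n‖ ≤ weight n ^ k * ‖c ε n‖ := by
        gcongr
        exact one_le_weight n
    _ ≤ C * |ε| ^ p := h1 n
    _ ≤ C * |ε| ^ q := by
        gcongr ?_ * ?_
        exact pow_le_pow_of_le_one (abs_nonneg ε) h2.le hq

lemma shift (hc : IsBig k p c) (m : ℤ) : IsBig k p fun ε n => c ε (n + m) := by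
  obtain ⟨C, hC, hc⟩ := hc
  have hm := weight_pos m
  refine ⟨weight m ^ k * C, by positivity, ?_⟩
  filter_upwards [hc] with ε h n
  have hn := weight_pos n
  calc weight n ^ k * ‖c ε (n + m)‖ ≤ (weight m * weight (n + m)) ^ k * ‖c ε (n + m)‖ := by
        gcongr
        exact weight_le_mul n m
    _ = weight m ^ k * (weight (n + m) ^ k * ‖c ε (n + m)‖) := by ring
    _ ≤ weight m ^ k * (C * |ε| ^ p) := mul_le_mul_of_nonneg_left (h _) (by positivity)
    _ = weight m ^ k * C * |ε| ^ p := by ring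

lemma param : IsBig 0 1 fun ε _ => (ε : ℂ) :=
  ⟨1, zero_le_one, by simp⟩

lemma const_zero_iff {f : ℤ → ℂ} :
    IsBig k 0 (fun _ => f) ↔ ∃ C : ℝ, ∀ n, weight n ^ k * ‖f n‖ ≤ C := by
  constructor
  · rintro ⟨C, -, h⟩
    exact ⟨C, by simpa using h.self_of_nhds⟩
  · rintro ⟨C, h⟩
    refine ⟨C, le_trans ?_ (h 0), by simpa using h⟩
    have := weight_pos 0
    positivity

lemma const (z : ℂ) : IsBig 0 0 fun _ _ => z :=
  const_zero_iff.2 ⟨‖z‖, by simp⟩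

end IsBig

/-- Rapidly decreasing scalar lattice functions. -/
def Rapid (f : ℤ → ℂ) : Prop := ∀ k, IsBig k 0 fun _ => f

/-- Bounded scalar lattice functions. -/
def Bdd (f : ℤ → ℂ) : Prop := IsBig 0 0 fun _ => f

/-! ### Rapidly decreasing functions as a module over the bounded ones -/

section Rapid

variable {f g : ℤ → ℂ}

lemma Rapid.add (hf : Rapid f) (hg : Rapid g) : Rapid fun n => f n + g n :=
  fun k => (hf k).add (hg k)

lemma Rapid.sub (hf : Rapid f) (hg : Rapid g) : Rapid fun n => f n - g n :=
  fun k => (hf k).sub (hg k)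

lemma Rapid.neg (hf : Rapid f) : Rapid fun n => -f n := fun k => (hf k).neg

lemma Rapid.mul (hf : Rapid f) (hg : Bdd g) : Rapid fun n => f n * g n :=
  fun k => (hf k).mul hg

lemma Rapid.mul_left (hf : Rapid f) (hg : Bdd g) : Rapid fun n => g n * f n := by
  simpa [mul_comm] using hf.mul hg

lemma Rapid.smul (hf : Rapid f) (z : ℂ) : Rapid fun n => z * f n := hf.mul_left (IsBig.const z)

lemma Rapid.shift (hf : Rapid f) (m : ℤ) : Rapid fun n => f (n + m) := fun k => (hf k).shift m

lemma Rapid.bdd (hf : Rapid f) : Bdd f := hf 0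

lemma Bdd.shift (hf : Bdd f) (m : ℤ) : Bdd fun n => f (n + m) := IsBig.shift hf m

lemma rapid_zero : Rapid fun _ => 0 := fun _ => IsBig.const_zero_iff.2 ⟨0, by simp⟩

lemma rapid_iff_abs : Rapid f ↔ ∀ k : ℕ, ∃ C : ℝ, ∀ n : ℤ, |(n : ℝ)| ^ k * ‖f n‖ ≤ C := by
  simp only [Rapid, IsBig.const_zero_iff]
  constructor
  · intro h k
    obtain ⟨C, h⟩ := h k
    refine ⟨C, fun n => le_trans ?_ (h n)⟩
    gcongr
    unfold weight
    linarith
  · intro h k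
    obtain ⟨C, hC⟩ := h k
    obtain ⟨D, hD⟩ := h 0
    -- The constant is that of the convexity bound `(1 + x)^k ≤ 2^(k-1) (1 + x^k)`.
    refine ⟨2 ^ (k - 1) * (D + C), fun n => ?_⟩
    have h1 : weight n ^ k ≤ 2 ^ (k - 1) * (1 ^ k + |(n : ℝ)| ^ k) :=
      add_pow_le zero_le_one (abs_nonneg _) k
    have hD' := hD n
    rw [pow_zero, one_mul] at hD'
    calc weight n ^ k * ‖f n‖ ≤ 2 ^ (k - 1) * (1 ^ k + |(n : ℝ)| ^ k) * ‖f n‖ := by gcongr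
      _ = 2 ^ (k - 1) * (‖f n‖ + |(n : ℝ)| ^ k * ‖f n‖) := by ring
      _ ≤ 2 ^ (k - 1) * (D + C) := by
          gcongr
          exact hC n

lemma rapidDecay_iff {h : Vec} :
    RapidDecay h ↔ (Rapid fun n => (h n).1) ∧ (Rapid fun n => (h n).2) := by
  simp only [rapid_iff_abs, RapidDecay]
  constructor
  · intro H
    refine ⟨fun k => ?_, fun k => ?_⟩ <;> obtain ⟨C, hC⟩ := H k <;>
      refine ⟨C, fun n => le_trans ?_ (hC n)⟩ <;> gcongr
    exacts [norm_fst_le _, norm_snd_le _]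
  · rintro ⟨h1, h2⟩ k
    obtain ⟨C, hC⟩ := h1 k
    obtain ⟨D, hD⟩ := h2 k
    refine ⟨max C D, fun n => ?_⟩
    rw [Prod.norm_def, mul_max_of_nonneg _ _ (by positivity)]
    exact max_le_max (hC n) (hD n)

end Rapid

/-! ### The summation operator -/

lemma summable_weight_inv : Summable fun n : ℤ => (weight n ^ 2)⁻¹ := by
  -- The extra summand at `n = 0` compensates for the convention `0⁻¹ = 0`.
  have h : Summable fun n : ℤ => |(n : ℝ)|⁻¹ ^ 2 + if n = 0 then 1 else 0 := by
    refine Summable.add ?_ (summable_of_ne_finset_zero (s := {0}) fun n hn => ?_)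
    · simpa using (Real.summable_one_div_int_pow (p := 2)).2 one_lt_two
    · simpa using hn
  refine Summable.of_nonneg_of_le (fun n => by have := weight_pos n; positivity) (fun n => ?_) h
  rcases eq_or_ne n 0 with rfl | hn
  · simp [weight]
  · have : 0 < |(n : ℝ)| := by simpa using hn
    simp only [hn, if_false, add_zero]
    rw [inv_pow]
    gcongr
    unfold weight
    linarith

/-- The sum of all weights `(1 + |n|)⁻²`. -/
def weightSum : ℝ := ∑' n : ℤ, (weight n ^ 2)⁻¹

lemma norm_le_of_weight {f : ℤ → ℂ} {C : ℝ} (hf : ∀ n, weight n ^ 2 * ‖f n‖ ≤ C) (n : ℤ) :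
    ‖f n‖ ≤ C * (weight n ^ 2)⁻¹ := by
  have := weight_pos n
  rw [← div_eq_mul_inv, le_div_iff₀ (by positivity), mul_comm]
  exact hf n

lemma summable_comp_of_weight {f : ℤ → ℂ} {C : ℝ} (hf : ∀ n, weight n ^ 2 * ‖f n‖ ≤ C)
    {i : ℕ → ℤ} (hi : Function.Injective i) : Summable fun k => f (i k) :=
  Summable.of_norm_bounded ((summable_weight_inv.mul_left C).comp_injective hi)
    fun k => norm_le_of_weight hf (i k)

/-- A half-line sum is dominated by part of the full weight sum, so the bound does not depend on the
endpoint. This makes `(E - 1)⁻¹ f` bounded uniformly in `n`. -/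
lemma norm_tsum_comp_le {f : ℤ → ℂ} {C : ℝ} (hf : ∀ n, weight n ^ 2 * ‖f n‖ ≤ C)
    {i : ℕ → ℤ} (hi : Function.Injective i) : ‖∑' k, f (i k)‖ ≤ C * weightSum := by
  have hC : 0 ≤ C := le_trans (by have := weight_pos 0; positivity) (hf 0)
  have h1 := (summable_weight_inv.mul_left C)
  refine (tsum_of_norm_bounded (h1.comp_injective hi).hasSum
    fun k => norm_le_of_weight hf (i k)).trans ?_
  rw [weightSum, ← tsum_mul_left]
  refine Summable.tsum_le_tsum_of_inj i hi (fun n _ => ?_) (fun k => le_rfl)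
    (h1.comp_injective hi) h1
  have := weight_pos n
  positivity

lemma injective_left (n : ℤ) : Function.Injective fun k : ℕ => n - 1 - (k : ℤ) :=
  fun a b h => by simpa using h

lemma injective_right (n : ℤ) : Function.Injective fun k : ℕ => n + (k : ℤ) :=
  fun a b h => by simpa using h

variable (θ : ℂ)

lemma norm_invDiff_le {f : ℤ → ℂ} {C : ℝ} (hf : ∀ n, weight n ^ 2 * ‖f n‖ ≤ C) (n : ℤ) :
    ‖invDiff θ f n‖ ≤ (‖θ‖ + ‖1 - θ‖) * weightSum * C := by
  unfold invDiff
  refine (norm_sub_le _ _).trans ?_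
  rw [norm_mul, norm_mul]
  have h1 := norm_tsum_comp_le hf (injective_left n)
  have h2 := norm_tsum_comp_le hf (injective_right n)
  have h3 := mul_le_mul_of_nonneg_left h1 (norm_nonneg θ)
  have h4 := mul_le_mul_of_nonneg_left h2 (norm_nonneg (1 - θ))
  linarith

lemma IsBig.invDiff {p : ℕ} {c : ℝ → ℤ → ℂ} (hc : IsBig 2 p c) :
    IsBig 0 p fun ε => invDiff θ (c ε) := by
  obtain ⟨C, hC, h⟩ := hc
  have hw : 0 ≤ weightSum := tsum_nonneg fun n => by have := weight_pos n; positivity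
  refine ⟨(‖θ‖ + ‖1 - θ‖) * weightSum * C, by positivity, ?_⟩
  filter_upwards [h] with ε h n
  rw [pow_zero, one_mul, mul_assoc _ C]
  exact norm_invDiff_le θ h n

/-- Enough decay for absolute summability. -/
abbrev Decay2 (f : ℤ → ℂ) : Prop := ∃ C : ℝ, ∀ n, weight n ^ 2 * ‖f n‖ ≤ C

lemma Rapid.decay2 {f : ℤ → ℂ} (hf : Rapid f) : Decay2 f := IsBig.const_zero_iff.1 (hf 2)

lemma Rapid.bdd_invDiff {f : ℤ → ℂ} (hf : Rapid f) : Bdd (invDiff θ f) := IsBig.invDiff θ (hf 2)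

section invDiff

variable {f g : ℤ → ℂ}

lemma invDiff_add (hf : Decay2 f) (hg : Decay2 g) :
    invDiff θ (fun n => f n + g n) = fun n => invDiff θ f n + invDiff θ g n := by
  obtain ⟨C, hf⟩ := hf
  obtain ⟨D, hg⟩ := hg
  funext n
  unfold invDiff
  rw [(summable_comp_of_weight hf (injective_left n)).tsum_add
      (summable_comp_of_weight hg (injective_left n)),
    (summable_comp_of_weight hf (injective_right n)).tsum_add
      (summable_comp_of_weight hg (injective_right n))]
  ring

lemma invDiff_smul (z : ℂ) : invDiff θ (fun n => z * f n) = fun n => z * invDiff θ f n := by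
  funext n
  unfold invDiff
  rw [tsum_mul_left, tsum_mul_left]
  ring

lemma invDiff_neg : invDiff θ (fun n => -f n) = fun n => -invDiff θ f n := by
  simpa using invDiff_smul θ (f := f) (-1)

lemma Decay2.neg (hf : Decay2 f) : Decay2 fun n => -f n := by
  simpa [Decay2] using hf

lemma invDiff_sub (hf : Decay2 f) (hg : Decay2 g) :
    invDiff θ (fun n => f n - g n) = fun n => invDiff θ f n - invDiff θ g n := by
  simp only [sub_eq_add_neg]
  rw [invDiff_add θ hf hg.neg, invDiff_neg]

lemma invDiff_succ_sub (hf : Decay2 f) (n : ℤ) : invDiff θ f (n + 1) - invDiff θ f n = f n := by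
  obtain ⟨C, hf⟩ := hf
  unfold invDiff
  rw [(summable_comp_of_weight hf (injective_left (n + 1))).tsum_eq_zero_add,
    (summable_comp_of_weight hf (injective_right n)).tsum_eq_zero_add]
  have h1 : ∀ k : ℕ, n + 1 - 1 - ((k + 1 : ℕ) : ℤ) = n - 1 - k := fun k => by push_cast; ring
  have h2 : ∀ k : ℕ, n + ((k + 1 : ℕ) : ℤ) = n + 1 + k := fun k => by push_cast; ring
  simp only [h1, h2]
  simp
  ring

/-- Holds for every `θ`: `(E - 1)⁻¹` commutes with the shift and is a right inverse of `E - 1`.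
Hence all rapidly decreasing functions are `Normalized`. -/
lemma invDiff_difference (hf : Rapid f) : invDiff θ (fun n => f (n + 1) - f n) = f := by
  obtain ⟨C, hC⟩ := hf.decay2
  rw [invDiff_sub θ (hf.shift 1).decay2 ⟨C, hC⟩]
  funext n
  have h : invDiff θ (fun n => f (n + 1)) n = invDiff θ f (n + 1) := by
    unfold invDiff
    have h1 : ∀ k : ℕ, n - 1 - (k : ℤ) + 1 = n + 1 - 1 - k := fun k => by ring
    have h2 : ∀ k : ℕ, n + (k : ℤ) + 1 = n + 1 + k := fun k => by ring
    simp only [h1, h2]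
  rw [h, invDiff_succ_sub θ ⟨C, hC⟩]

end invDiff

/-- The lattice functions that are reproduced from their differences by `(E - 1)⁻¹`. -/
def Normalized : Submodule ℂ (ℤ → ℂ) where
  carrier := {g | Rapid (fun n => g (n + 1) - g n) ∧ invDiff θ (fun n => g (n + 1) - g n) = g}
  zero_mem' := by
    refine ⟨by simpa using rapid_zero, ?_⟩
    funext n
    simp [invDiff]
  add_mem' := by
    rintro f g ⟨hf, hf'⟩ ⟨hg, hg'⟩
    have h : (fun n => (f + g) (n + 1) - (f + g) n) =
        fun n => (f (n + 1) - f n) + (g (n + 1) - g n) := by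
      funext n; simp only [Pi.add_apply]; ring
    refine ⟨h ▸ hf.add hg, ?_⟩
    rw [h, invDiff_add θ hf.decay2 hg.decay2, hf', hg']
    rfl
  smul_mem' := by
    rintro z f ⟨hf, hf'⟩
    have h : (fun n => (z • f) (n + 1) - (z • f) n) = fun n => z * (f (n + 1) - f n) := by
      funext n; simp only [Pi.smul_apply, smul_eq_mul]; ring
    refine ⟨h ▸ hf.smul z, ?_⟩
    rw [h, invDiff_smul, hf']
    rfl

section Normalized

variable {θ} {f g : ℤ → ℂ}

lemma Rapid.normalized (hf : Rapid f) : f ∈ Normalized θ :=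
  ⟨(hf.shift 1).sub hf, invDiff_difference θ hf⟩

lemma Rapid.invDiff_normalized (hf : Rapid f) : invDiff θ f ∈ Normalized θ := by
  have h : (fun n => invDiff θ f (n + 1) - invDiff θ f n) = f :=
    funext fun n => invDiff_succ_sub θ hf.decay2 n
  refine ⟨h.symm ▸ hf, by rw [h]⟩

lemma Normalized.eq_invDiff (hg : g ∈ Normalized θ) (h : ∀ n, g (n + 1) - g n = f n) :
    invDiff θ f = g := by
  rw [← funext h]
  exact hg.2

/-- The uniqueness principle behind all identities between nonlocal terms: only their differences
have to be compared, and no constant of summation survives. -/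
lemma Normalized.eq_zero (hg : g ∈ Normalized θ) (h : ∀ n, g (n + 1) - g n = 0) (n : ℤ) :
    g n = 0 := by
  rw [← Normalized.eq_invDiff hg h]
  simp [invDiff]

end Normalized

end

section

open Filter Topology

/-! ### First order expansions of families -/

/-- `c ε = a + ε b + O(ε²)`, uniformly with respect to the weight `(1 + |n|)^k`. -/
structure Jet (k : ℕ) (c : ℝ → ℤ → ℂ) (a b : ℤ → ℂ) : Prop where
  rem : IsBig k 2 fun ε n => c ε n - a n - ε * b n
  val : IsBig k 0 fun _ => a
  der : IsBig k 0 fun _ => b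

namespace Jet

variable {k l : ℕ} {c d : ℝ → ℤ → ℂ} {a b a' b' : ℤ → ℂ}

lemma congr (h : Jet k c a b) (hcd : ∀ᶠ ε in 𝓝 (0 : ℝ), c ε = d ε) : Jet k d a b :=
  ⟨h.rem.congr (by filter_upwards [hcd] with ε hε; rw [hε]), h.val, h.der⟩

lemma of_eq (h : Jet k c a b) (ha : a = a') (hb : b = b') : Jet k c a' b' := ha ▸ hb ▸ h

lemma mono (h : Jet k c a b) (hl : l ≤ k) : Jet l c a b :=
  ⟨h.rem.mono hl le_rfl, h.val.mono hl le_rfl, h.der.mono hl le_rfl⟩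

lemma first_order (h : Jet k c a b) : IsBig k 1 fun ε n => c ε n - a n := by
  have h1 : IsBig k 1 fun ε n => (ε : ℂ) * b n := by simpa using IsBig.param.mul h.der
  refine ((h.rem.mono le_rfl one_le_two).add h1).congr (Eventually.of_forall fun ε => ?_)
  funext n
  ring

lemma isBig (h : Jet k c a b) : IsBig k 0 c := by
  refine ((h.first_order.mono le_rfl zero_le_one).add h.val).congr
    (Eventually.of_forall fun ε => ?_)
  funext n
  ring

lemma const (ha : IsBig k 0 fun _ => a) : Jet k (fun _ => a) a fun _ => 0 := by
  refine ⟨⟨0, le_rfl, by simp⟩, ha, IsBig.const_zero_iff.2 ⟨0, by simp⟩⟩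

lemma line (ha : IsBig k 0 fun _ => a) (hb : IsBig k 0 fun _ => b) :
    Jet k (fun ε n => a n + ε * b n) a b :=
  ⟨⟨0, le_rfl, by simp⟩, ha, hb⟩

lemma add (h : Jet k c a b) (h' : Jet k d a' b') :
    Jet k (fun ε n => c ε n + d ε n) (fun n => a n + a' n) fun n => b n + b' n := by
  refine ⟨(h.rem.add h'.rem).congr (Eventually.of_forall fun ε => ?_), h.val.add h'.val,
    h.der.add h'.der⟩
  funext n
  ring

lemma neg (h : Jet k c a b) : Jet k (fun ε n => -c ε n) (fun n => -a n) fun n => -b n := by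
  refine ⟨h.rem.neg.congr (Eventually.of_forall fun ε => ?_), h.val.neg, h.der.neg⟩
  funext n
  ring

lemma sub (h : Jet k c a b) (h' : Jet k d a' b') :
    Jet k (fun ε n => c ε n - d ε n) (fun n => a n - a' n) fun n => b n - b' n := by
  simpa only [sub_eq_add_neg] using h.add h'.neg

lemma mul (h : Jet k c a b) (h' : Jet l d a' b') :
    Jet (k + l) (fun ε n => c ε n * d ε n) (fun n => a n * a' n)
      fun n => b n * a' n + a n * b' n := by
  refine ⟨?_, h.val.mul h'.val, (h.der.mul h'.val).add (h.val.mul h'.der)⟩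
  have hε : IsBig k 1 fun ε n => (ε : ℂ) * b n := by simpa using IsBig.param.mul h.der
  refine (((h.rem.mul h'.isBig).add (h.val.mul h'.rem)).add (hε.mul h'.first_order)).congr
    (Eventually.of_forall fun ε => ?_)
  funext n
  ring

lemma shift (h : Jet k c a b) (m : ℤ) :
    Jet k (fun ε n => c ε (n + m)) (fun n => a (n + m)) fun n => b (n + m) :=
  ⟨h.rem.shift m, h.val.shift m, h.der.shift m⟩

/-- The lower bound on `a` passes to `c ε` at all sites simultaneously, because `c ε - a` is
uniformly `O(ε)`; hence the inverses stay uniformly bounded. -/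
lemma inv (h : Jet 0 c a b) {δ : ℝ} (hδ : 0 < δ) (ha : ∀ n, δ ≤ ‖a n‖) :
    (∀ᶠ ε in 𝓝 (0 : ℝ), ∀ n, c ε n ≠ 0) ∧
      Jet 0 (fun ε n => (c ε n)⁻¹) (fun n => (a n)⁻¹) fun n => -(b n * (a n)⁻¹ * (a n)⁻¹) := by
  have hlow : ∀ᶠ ε in 𝓝 (0 : ℝ), ∀ n, δ / 2 ≤ ‖c ε n‖ := by
    obtain ⟨C, hC, hc⟩ := h.first_order
    have : ∀ᶠ ε in 𝓝 (0 : ℝ), C * |ε| ^ 1 < δ / 2 := by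
      have ht : Tendsto (fun ε : ℝ => C * |ε| ^ 1) (𝓝 0) (𝓝 (C * |(0 : ℝ)| ^ 1)) :=
        (Continuous.tendsto (by fun_prop) 0)
      exact ht.eventually_lt_const (by simpa using half_pos hδ)
    filter_upwards [hc, this] with ε h1 h2 n
    have h3 := h1 n
    rw [pow_zero, one_mul] at h3
    have h4 := norm_sub_norm_le (a n) (c ε n)
    rw [norm_sub_rev] at h4
    linarith [ha n]
  have hne : ∀ᶠ ε in 𝓝 (0 : ℝ), ∀ n, c ε n ≠ 0 := by
    filter_upwards [hlow] with ε hε n h0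
    have := hε n
    rw [h0, norm_zero] at this
    linarith
  have hci : IsBig 0 0 fun ε n => (c ε n)⁻¹ := by
    refine ⟨(δ / 2)⁻¹, by positivity, ?_⟩
    filter_upwards [hlow] with ε hε n
    simp only [pow_zero, one_mul, mul_one, norm_inv]
    exact inv_anti₀ (by positivity) (hε n)
  have hai : IsBig 0 0 fun _ n => (a n)⁻¹ := by
    refine IsBig.const_zero_iff.2 ⟨δ⁻¹, fun n => ?_⟩
    simp only [pow_zero, one_mul, norm_inv]
    exact inv_anti₀ hδ (ha n)
  have hane : ∀ n, a n ≠ 0 := fun n h0 => by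
    have := ha n
    rw [h0, norm_zero] at this
    linarith
  refine ⟨hne, ?_, hai, ((h.der.mul hai).mul hai).neg⟩
  have hε : IsBig 0 1 fun ε n => (ε : ℂ) * b n := by simpa using IsBig.param.mul h.der
  -- With `r = c - a - ε b`, the remainder of `c⁻¹` is `(ε b (c - a) a⁻¹ - r) c⁻¹ a⁻¹`.
  refine ((((hε.mul h.first_order).mul hai).sub h.rem).mul (hci.mul hai)).congr ?_
  filter_upwards [hne] with ε hne
  funext n
  have h1 := hne n
  have h2 := hane n
  field_simp
  ring

/-- Termwise differentiation of the sums: the remainder is summed like any other function, and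
weight 2 suffices for a bound uniform in `n`. -/
lemma invDiff (θ : ℂ) (h : Jet 2 c a b) :
    Jet 0 (fun ε => invDiff θ (c ε)) (invDiff θ a) (invDiff θ b) := by
  refine ⟨(h.rem.invDiff θ).congr ?_, h.val.invDiff θ, h.der.invDiff θ⟩
  obtain ⟨C, -, hc⟩ := h.isBig
  have ha : Decay2 a := IsBig.const_zero_iff.1 h.val
  obtain ⟨D, hb⟩ : Decay2 b := IsBig.const_zero_iff.1 h.der
  filter_upwards [hc] with ε hc
  have hcε : Decay2 (c ε) := ⟨_, hc⟩
  have hbε : Decay2 fun n => (ε : ℂ) * b n := ⟨|ε| * D, fun n => by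
    rw [norm_mul, Complex.norm_real, Real.norm_eq_abs, mul_left_comm]
    exact mul_le_mul_of_nonneg_left (hb n) (abs_nonneg ε)⟩
  have hca : Decay2 fun n => c ε n - a n := by
    obtain ⟨C', ha⟩ := ha
    refine ⟨C * |ε| ^ 0 + C', fun n => ?_⟩
    have := mul_le_mul_of_nonneg_left (norm_sub_le (c ε n) (a n))
      (pow_nonneg (weight_pos n).le 2)
    linarith [hc n, ha n]
  rw [invDiff_sub θ hca hbε, invDiff_sub θ hcε ha, invDiff_smul]

lemma eq_val (h : Jet 0 c a b) (n : ℤ) : c 0 n = a n := by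
  obtain ⟨C, -, hc⟩ := h.rem
  have h0 := hc.self_of_nhds n
  simp only [Complex.ofReal_zero, zero_mul, sub_zero, pow_zero, one_mul, abs_zero, ne_eq,
    OfNat.ofNat_ne_zero, not_false_eq_true, zero_pow, mul_zero, norm_le_zero_iff] at h0
  exact sub_eq_zero.1 h0

lemma hasDerivAt (h : Jet 0 c a b) (n : ℤ) : HasDerivAt (fun ε => c ε n) (b n) 0 := by
  rw [hasDerivAt_iff_isLittleO]
  obtain ⟨C, hC, hc⟩ := h.rem
  have h1 : (fun ε : ℝ => c ε n - c 0 n - (ε - 0) • b n) =O[𝓝 0] fun ε : ℝ => ε ^ 2 := by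
    refine Asymptotics.IsBigO.of_bound C ?_
    filter_upwards [hc] with ε hε
    have := hε n
    rw [pow_zero, one_mul] at this
    simpa [h.eq_val n] using this
  refine h1.trans_isLittleO ?_
  simpa using Asymptotics.isLittleO_pow_id (𝕜 := ℝ) one_lt_two

end Jet

/-- First order expansions of families of rapidly decreasing functions. -/
def RapidJet (c : ℝ → ℤ → ℂ) (a b : ℤ → ℂ) : Prop := ∀ k, Jet k c a b

namespace RapidJet

variable {c d : ℝ → ℤ → ℂ} {a b a' b' : ℤ → ℂ}

lemma add (h : RapidJet c a b) (h' : RapidJet d a' b') :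
    RapidJet (fun ε n => c ε n + d ε n) (fun n => a n + a' n) fun n => b n + b' n :=
  fun k => (h k).add (h' k)

lemma sub (h : RapidJet c a b) (h' : RapidJet d a' b') :
    RapidJet (fun ε n => c ε n - d ε n) (fun n => a n - a' n) fun n => b n - b' n :=
  fun k => (h k).sub (h' k)

lemma mul (h : RapidJet c a b) (h' : Jet 0 d a' b') :
    RapidJet (fun ε n => c ε n * d ε n) (fun n => a n * a' n) fun n => b n * a' n + a n * b' n :=
  fun k => (h k).mul h'

lemma shift (h : RapidJet c a b) (m : ℤ) :
    RapidJet (fun ε n => c ε (n + m)) (fun n => a (n + m)) fun n => b (n + m) :=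
  fun k => (h k).shift m

lemma invDiff (θ : ℂ) (h : RapidJet c a b) :
    Jet 0 (fun ε => invDiff θ (c ε)) (invDiff θ a) (invDiff θ b) := (h 2).invDiff θ

lemma bdd (h : RapidJet c a b) : Jet 0 c a b := h 0

end RapidJet

/-- First order expansions of families of rapidly decreasing pairs. -/
structure VecJet (c : ℝ → Vec) (a b : Vec) : Prop where
  fst : RapidJet (fun ε n => (c ε n).1) (fun n => (a n).1) fun n => (b n).1
  snd : RapidJet (fun ε n => (c ε n).2) (fun n => (a n).2) fun n => (b n).2

lemma VecJet.congr {c d : ℝ → Vec} {a b : Vec} (h : VecJet c a b)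
    (hcd : ∀ᶠ ε in 𝓝 (0 : ℝ), c ε = d ε) : VecJet d a b :=
  ⟨fun k => (h.fst k).congr (by filter_upwards [hcd] with ε hε; rw [hε]),
    fun k => (h.snd k).congr (by filter_upwards [hcd] with ε hε; rw [hε])⟩

lemma VecJet.hasDerivAt {c : ℝ → Vec} {a b : Vec} (h : VecJet c a b) (n : ℤ) :
    HasDerivAt (fun ε => c ε n) (b n) 0 :=
  (h.fst.bdd.hasDerivAt n).prodMk (h.snd.bdd.hasDerivAt n)

lemma VecJet.unique_der {c : ℝ → Vec} {a b a' b' : Vec} (h : VecJet c a b)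
    (h' : VecJet c a' b') : b = b' :=
  funext fun n => (h.hasDerivAt n).unique (h'.hasDerivAt n)

/-- The rapidly decreasing sequences of pairs. -/
def rapidVec : Submodule ℂ Vec where
  carrier := {h | RapidDecay h}
  zero_mem' := rapidDecay_iff.2 ⟨rapid_zero, rapid_zero⟩
  add_mem' := by
    intro f g hf hg
    obtain ⟨hf1, hf2⟩ := rapidDecay_iff.1 hf
    obtain ⟨hg1, hg2⟩ := rapidDecay_iff.1 hg
    exact rapidDecay_iff.2 ⟨hf1.add hg1, hf2.add hg2⟩
  smul_mem' := by
    intro z f hf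
    obtain ⟨hf1, hf2⟩ := rapidDecay_iff.1 hf
    exact rapidDecay_iff.2 ⟨hf1.smul z, hf2.smul z⟩

/-- The space of rapidly decreasing sequences of pairs. -/
abbrev RapidVec : Type := rapidVec

lemma RapidVec.fst (h : RapidVec) : Rapid fun n => (h.1 n).1 := (rapidDecay_iff.1 h.2).1

lemma RapidVec.snd (h : RapidVec) : Rapid fun n => (h.1 n).2 := (rapidDecay_iff.1 h.2).2

/-! ### The phase space -/

namespace Phase

variable (u : Phase)

lemma rapid_fst : Rapid fun n => (u.1 n).1 := (rapidDecay_iff.1 u.2.1).1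

lemma rapid_snd : Rapid fun n => (u.1 n).2 := (rapidDecay_iff.1 u.2.1).2

lemma gammaSq_ne_zero (n : ℤ) : gammaSq u.1 n ≠ 0 := u.2.2 n

/-- Outside a finite window the decay forces `|Q_n R_n| ≤ 1/2`; inside it a minimum of finitely many
nonzero values is taken. -/
lemma exists_le_norm_gammaSq : ∃ δ : ℝ, 0 < δ ∧ ∀ n, δ ≤ ‖gammaSq u.1 n‖ := by
  obtain ⟨C, hC⟩ := IsBig.const_zero_iff.1 (u.rapid_fst.mul u.rapid_snd.bdd 1)
  have hfin : (Set.Icc (-⌈2 * C⌉) ⌈2 * C⌉ : Set ℤ).Finite := Set.finite_Icc _ _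
  obtain ⟨δ, hδ, h⟩ : ∃ δ : ℝ, 0 < δ ∧ ∀ n ∈ Set.Icc (-⌈2 * C⌉) ⌈2 * C⌉,
      δ ≤ ‖gammaSq u.1 n‖ := by
    rcases (Set.Icc (-⌈2 * C⌉) ⌈2 * C⌉ : Set ℤ).eq_empty_or_nonempty with h0 | h0
    · exact ⟨1, one_pos, by simp [h0]⟩
    · obtain ⟨m, -, hm⟩ := hfin.exists_minimalFor (fun n => ‖gammaSq u.1 n‖) _ h0
      refine ⟨‖gammaSq u.1 m‖, norm_pos_iff.2 (u.gammaSq_ne_zero m), fun n hn => ?_⟩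
      exact (le_total ‖gammaSq u.1 m‖ ‖gammaSq u.1 n‖).elim id (hm hn)
  refine ⟨min δ (1 / 2), by positivity, fun n => ?_⟩
  by_cases hn : n ∈ Set.Icc (-⌈2 * C⌉) ⌈2 * C⌉
  · exact (min_le_left _ _).trans (h n hn)
  · refine (min_le_right _ _).trans ?_
    have h1 : 2 * C ≤ weight n := by
      have : 2 * C < |(n : ℝ)| := by
        by_contra hle
        rw [not_lt] at hle
        refine hn (abs_le.1 ?_)
        exact_mod_cast hle.trans (Int.le_ceil _)
      unfold weight
      linarith
    have h2 : ‖(u.1 n).1 * (u.1 n).2‖ ≤ 1 / 2 := by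
      have hw := weight_pos n
      have := hC n
      rw [pow_one] at this
      by_contra hlt
      rw [not_le] at hlt
      nlinarith
    have h3 := norm_sub_norm_le (1 : ℂ) ((u.1 n).1 * (u.1 n).2)
    rw [norm_one] at h3
    unfold gammaSq
    linarith

lemma bdd_inv_gammaSq : Bdd fun n => (gammaSq u.1 n)⁻¹ := by
  obtain ⟨δ, hδ, h⟩ := u.exists_le_norm_gammaSq
  refine IsBig.const_zero_iff.2 ⟨δ⁻¹, fun n => ?_⟩
  simp only [pow_zero, one_mul, norm_inv]
  exact inv_anti₀ hδ (h n)

variable (v : RapidVec)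

lemma jet_line : VecJet (fun ε => u.1 + ε • v.1) u.1 v.1 := by
  constructor <;> intro k
  · simpa using Jet.line (u.rapid_fst k) (v.fst k)
  · simpa using Jet.line (u.rapid_snd k) (v.snd k)

/-- The derivative of `γ_n²` in the direction `v`. -/
def gammaDer (u v : Vec) (n : ℤ) : ℂ := -((v n).1 * (u n).2 + (u n).1 * (v n).2)

lemma jet_gammaSq : Jet 0 (fun ε => gammaSq (u.1 + ε • v.1)) (gammaSq u.1) (gammaDer u.1 v.1) := by
  have h := (Jet.const (IsBig.const (1 : ℂ))).sub ((u.jet_line v).fst.mul (u.jet_line v).snd.bdd).bdd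
  refine h.of_eq rfl ?_
  funext n
  simp [gammaDer]

/-- The phase space is open along rapidly decreasing directions, so the default value in `alongLine`
does not affect derivatives at `0`. -/
lemma eventually_mem : ∀ᶠ ε in 𝓝 (0 : ℝ), ∃ w : Phase, w.1 = u.1 + ε • v.1 := by
  obtain ⟨δ, hδ, h⟩ := u.exists_le_norm_gammaSq
  filter_upwards [((u.jet_gammaSq v).inv hδ h).1] with ε hε
  exact ⟨⟨u.1 + ε • v.1, rapidVec.add_mem u.2.1 (rapidVec.smul_mem (ε : ℂ) v.2), hε⟩, rfl⟩

lemma jet_inv_gammaSq : Jet 0 (fun ε n => (gammaSq (u.1 + ε • v.1) n)⁻¹)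
    (fun n => (gammaSq u.1 n)⁻¹)
    fun n => -(gammaDer u.1 v.1 n * (gammaSq u.1 n)⁻¹ * (gammaSq u.1 n)⁻¹) := by
  obtain ⟨δ, hδ, h⟩ := u.exists_le_norm_gammaSq
  exact ((u.jet_gammaSq v).inv hδ h).2

end Phase

end

section

open Filter Topology

variable {θ : ℂ}

lemma Normalized.bdd {g : ℤ → ℂ} (hg : g ∈ Normalized θ) : Bdd g :=
  hg.2 ▸ hg.1.bdd_invDiff θ

/-! ### The recursion operator as a zero curvature relation -/

/-- The entries of a matrix `N = ((a, z b), (z c, z² t))` with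
`(E N) U - U N = U'[w] - z² U'[h]`, where `U = ((z, Q), (R, z⁻¹))`. -/
structure LaxData (θ : ℂ) (u h w : Vec) where
  a : ℤ → ℂ
  b : ℤ → ℂ
  c : ℤ → ℂ
  t : ℤ → ℂ
  norm_a : a ∈ Normalized θ
  norm_t : t ∈ Normalized θ
  b_eq : ∀ n, b n = (h n).1 - (u n).1 * t n
  c_eq : ∀ n, c (n + 1) = -(h n).2 - (u n).2 * t (n + 1)
  t_eq : ∀ n, (1 - (u n).1 * (u n).2) * (t (n + 1) - t n) =
    (u n).2 * (h n).1 + (u n).1 * (h n).2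
  a_eq : ∀ n, a (n + 1) - a n = (u n).1 * c n - (u n).2 * b (n + 1)
  fst_eq : ∀ n, (w n).1 = (u n).1 * a (n + 1) + b (n + 1)
  snd_eq : ∀ n, (w n).2 = -(u n).2 * a n - c n

/-- The derivative of zero curvature data in the direction `v`. -/
structure LaxDer {u h w : Vec} (D : LaxData θ u h w) (v d : Vec) where
  a : ℤ → ℂ
  b : ℤ → ℂ
  c : ℤ → ℂ
  t : ℤ → ℂ
  norm_a : a ∈ Normalized θ
  norm_t : t ∈ Normalized θ
  b_eq : ∀ n, b n = -(v n).1 * D.t n - (u n).1 * t n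
  c_eq : ∀ n, c (n + 1) = -(v n).2 * D.t (n + 1) - (u n).2 * t (n + 1)
  t_eq : ∀ n, (1 - (u n).1 * (u n).2) * (t (n + 1) - t n) =
    ((u n).1 * (v n).2 + (u n).2 * (v n).1) * (D.t (n + 1) - D.t n) +
      (v n).2 * (h n).1 + (v n).1 * (h n).2
  a_eq : ∀ n, a (n + 1) - a n =
    (v n).1 * D.c n + (u n).1 * c n - (v n).2 * D.b (n + 1) - (u n).2 * b (n + 1)
  fst_eq : ∀ n, (d n).1 = (v n).1 * D.a (n + 1) + (u n).1 * a (n + 1) + b (n + 1)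
  snd_eq : ∀ n, (d n).2 = -(v n).2 * D.a n - (u n).2 * a n - c n

lemma forall_of_forall_succ {P : ℤ → Prop} (h : ∀ n, P (n + 1)) (n : ℤ) : P n := by
  simpa using h (n - 1)

/-! ### Linearity, uniqueness and decay for zero curvature data -/

namespace LaxData

variable {u h w h' w' : Vec}

lemma c_eq' (D : LaxData θ u h w) (n : ℤ) :
    D.c n = -(h (n - 1)).2 - (u (n - 1)).2 * D.t n := by
  simpa using D.c_eq (n - 1)

/-- The `(2,2)` entry of the zero curvature relation as it stands; `t_eq` is the form with `b` and
`c` eliminated, which determines the differences of `t` from `h`. -/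
lemma t_eq' (D : LaxData θ u h w) (n : ℤ) :
    D.t (n + 1) - D.t n = (u n).2 * D.b n - (u n).1 * D.c (n + 1) := by
  linear_combination D.t_eq n - (u n).2 * D.b_eq n + (u n).1 * D.c_eq n

/-- Sums of zero curvature data. -/
def add (D : LaxData θ u h w) (D' : LaxData θ u h' w') : LaxData θ u (h + h') (w + w') where
  a := D.a + D'.a
  b := D.b + D'.b
  c := D.c + D'.c
  t := D.t + D'.t
  norm_a := add_mem D.norm_a D'.norm_a
  norm_t := add_mem D.norm_t D'.norm_t
  b_eq n := by
    simp only [Pi.add_apply, Prod.fst_add]; linear_combination D.b_eq n + D'.b_eq n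
  c_eq n := by
    simp only [Pi.add_apply, Prod.snd_add]; linear_combination D.c_eq n + D'.c_eq n
  t_eq n := by
    simp only [Pi.add_apply, Prod.fst_add, Prod.snd_add]
    linear_combination D.t_eq n + D'.t_eq n
  a_eq n := by
    simp only [Pi.add_apply]; linear_combination D.a_eq n + D'.a_eq n
  fst_eq n := by
    simp only [Pi.add_apply, Prod.fst_add]; linear_combination D.fst_eq n + D'.fst_eq n
  snd_eq n := by
    simp only [Pi.add_apply, Prod.snd_add]; linear_combination D.snd_eq n + D'.snd_eq n

/-- Multiples of zero curvature data. -/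
def smul (z : ℂ) (D : LaxData θ u h w) : LaxData θ u (z • h) (z • w) where
  a := z • D.a
  b := z • D.b
  c := z • D.c
  t := z • D.t
  norm_a := Submodule.smul_mem _ z D.norm_a
  norm_t := Submodule.smul_mem _ z D.norm_t
  b_eq n := by
    simp only [Pi.smul_apply, Prod.smul_fst, smul_eq_mul]; linear_combination z * D.b_eq n
  c_eq n := by
    simp only [Pi.smul_apply, Prod.smul_snd, smul_eq_mul]; linear_combination z * D.c_eq n
  t_eq n := by
    simp only [Pi.smul_apply, Prod.smul_fst, Prod.smul_snd, smul_eq_mul]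
    linear_combination z * D.t_eq n
  a_eq n := by
    simp only [Pi.smul_apply, smul_eq_mul]; linear_combination z * D.a_eq n
  fst_eq n := by
    simp only [Pi.smul_apply, Prod.smul_fst, smul_eq_mul]; linear_combination z * D.fst_eq n
  snd_eq n := by
    simp only [Pi.smul_apply, Prod.smul_snd, smul_eq_mul]; linear_combination z * D.snd_eq n

/-- Since `γ_n² ≠ 0`, the differences of `t` are determined by `h`, and the normalization determines
`t`. Then `b` and `c` follow algebraically, next `a` by the same argument, and finally `w`. -/
lemma t_unique (hu : ∀ n, gammaSq u n ≠ 0) (D : LaxData θ u h w) (D' : LaxData θ u h w')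
    (n : ℤ) : D.t n = D'.t n :=
  sub_eq_zero.1 <| Normalized.eq_zero (g := D.t - D'.t) (sub_mem D.norm_t D'.norm_t)
    (fun n => mul_left_cancel₀ (hu n) (by
      simp only [gammaSq, Pi.sub_apply]
      linear_combination D.t_eq n - D'.t_eq n)) n

lemma b_unique (hu : ∀ n, gammaSq u n ≠ 0) (D : LaxData θ u h w) (D' : LaxData θ u h w')
    (n : ℤ) : D.b n = D'.b n := by
  rw [D.b_eq, D'.b_eq, D.t_unique hu D']

lemma c_unique (hu : ∀ n, gammaSq u n ≠ 0) (D : LaxData θ u h w) (D' : LaxData θ u h w')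
    (n : ℤ) : D.c n = D'.c n := by
  rw [D.c_eq', D'.c_eq', D.t_unique hu D']

lemma a_unique (hu : ∀ n, gammaSq u n ≠ 0) (D : LaxData θ u h w) (D' : LaxData θ u h w')
    (n : ℤ) : D.a n = D'.a n :=
  sub_eq_zero.1 <| Normalized.eq_zero (g := D.a - D'.a) (sub_mem D.norm_a D'.norm_a)
    (fun n => by
      simp only [Pi.sub_apply]
      linear_combination D.a_eq n - D'.a_eq n + (u n).1 * D.c_unique hu D' n -
        (u n).2 * D.b_unique hu D' (n + 1)) n

lemma unique (hu : ∀ n, gammaSq u n ≠ 0) (D : LaxData θ u h w) (D' : LaxData θ u h w') :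
    w = w' := by
  funext n
  refine Prod.ext ?_ ?_
  · rw [D.fst_eq, D'.fst_eq, D.a_unique hu D', D.b_unique hu D']
  · rw [D.snd_eq, D'.snd_eq, D.a_unique hu D', D.c_unique hu D']

/-- The off-diagonal entries decay although the diagonal ones are merely bounded. Products `b c`
from matrix commutators are therefore `Normalized`. -/
lemma rapid_b (u : Phase) (h : RapidVec) (D : LaxData θ u.1 h.1 w) : Rapid D.b := by
  rw [funext D.b_eq]
  exact h.fst.sub (u.rapid_fst.mul (Normalized.bdd D.norm_t))

lemma rapid_c (u : Phase) (h : RapidVec) (D : LaxData θ u.1 h.1 w) : Rapid D.c := by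
  rw [funext D.c_eq']
  exact (h.snd.shift (-1)).neg.sub ((u.rapid_snd.shift (-1)).mul (Normalized.bdd D.norm_t))

lemma rapidDecay (u : Phase) (h : RapidVec) (D : LaxData θ u.1 h.1 w) : RapidDecay w := by
  refine rapidDecay_iff.2 ⟨?_, ?_⟩
  · rw [funext D.fst_eq]
    exact (u.rapid_fst.mul ((Normalized.bdd D.norm_a).shift 1)).add ((D.rapid_b u h).shift 1)
  · rw [funext D.snd_eq]
    exact (u.rapid_snd.neg.mul (Normalized.bdd D.norm_a)).sub (D.rapid_c u h)

end LaxData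

/-! ### Linearity, uniqueness and decay for differentiated data -/

namespace LaxDer

variable {u h w v d v' d' : Vec} {D : LaxData θ u h w}

lemma c_eq' (A : LaxDer D v d) (n : ℤ) :
    A.c n = -(v (n - 1)).2 * D.t n - (u (n - 1)).2 * A.t n := by
  simpa using A.c_eq (n - 1)

lemma t_eq' (A : LaxDer D v d) (n : ℤ) :
    A.t (n + 1) - A.t n = (v n).2 * D.b n + (u n).2 * A.b n - (v n).1 * D.c (n + 1) -
      (u n).1 * A.c (n + 1) := by
  linear_combination A.t_eq n - (v n).2 * D.b_eq n - (u n).2 * A.b_eq n +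
    (v n).1 * D.c_eq n + (u n).1 * A.c_eq n

/-- Derivatives of zero curvature data are additive in the direction. -/
def add (A : LaxDer D v d) (A' : LaxDer D v' d') : LaxDer D (v + v') (d + d') where
  a := A.a + A'.a
  b := A.b + A'.b
  c := A.c + A'.c
  t := A.t + A'.t
  norm_a := add_mem A.norm_a A'.norm_a
  norm_t := add_mem A.norm_t A'.norm_t
  b_eq n := by
    simp only [Pi.add_apply, Prod.fst_add]; linear_combination A.b_eq n + A'.b_eq n
  c_eq n := by
    simp only [Pi.add_apply, Prod.snd_add]; linear_combination A.c_eq n + A'.c_eq n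
  t_eq n := by
    simp only [Pi.add_apply, Prod.fst_add, Prod.snd_add]
    linear_combination A.t_eq n + A'.t_eq n
  a_eq n := by
    simp only [Pi.add_apply, Prod.fst_add, Prod.snd_add]
    linear_combination A.a_eq n + A'.a_eq n
  fst_eq n := by
    simp only [Pi.add_apply, Prod.fst_add]; linear_combination A.fst_eq n + A'.fst_eq n
  snd_eq n := by
    simp only [Pi.add_apply, Prod.snd_add]; linear_combination A.snd_eq n + A'.snd_eq n

/-- Derivatives of zero curvature data are homogeneous in the direction. -/
def smul (z : ℂ) (A : LaxDer D v d) : LaxDer D (z • v) (z • d) where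
  a := z • A.a
  b := z • A.b
  c := z • A.c
  t := z • A.t
  norm_a := Submodule.smul_mem _ z A.norm_a
  norm_t := Submodule.smul_mem _ z A.norm_t
  b_eq n := by
    simp only [Pi.smul_apply, Prod.smul_fst, smul_eq_mul]; linear_combination z * A.b_eq n
  c_eq n := by
    simp only [Pi.smul_apply, Prod.smul_snd, smul_eq_mul]; linear_combination z * A.c_eq n
  t_eq n := by
    simp only [Pi.smul_apply, Prod.smul_fst, Prod.smul_snd, smul_eq_mul]
    linear_combination z * A.t_eq n
  a_eq n := by
    simp only [Pi.smul_apply, Prod.smul_fst, Prod.smul_snd, smul_eq_mul]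
    linear_combination z * A.a_eq n
  fst_eq n := by
    simp only [Pi.smul_apply, Prod.smul_fst, smul_eq_mul]; linear_combination z * A.fst_eq n
  snd_eq n := by
    simp only [Pi.smul_apply, Prod.smul_snd, smul_eq_mul]; linear_combination z * A.snd_eq n

lemma unique (hu : ∀ n, gammaSq u n ≠ 0) (A : LaxDer D v d) (A' : LaxDer D v d') :
    d = d' := by
  have ht : ∀ n, A.t n = A'.t n := fun n =>
    sub_eq_zero.1 <| Normalized.eq_zero (g := A.t - A'.t) (sub_mem A.norm_t A'.norm_t)
      (fun n => mul_left_cancel₀ (hu n) (by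
        simp only [gammaSq, Pi.sub_apply]
        linear_combination A.t_eq n - A'.t_eq n)) n
  have hb : ∀ n, A.b n = A'.b n := fun n => by rw [A.b_eq, A'.b_eq, ht]
  have hc : ∀ n, A.c n = A'.c n := fun n => by rw [A.c_eq', A'.c_eq', ht]
  have ha : ∀ n, A.a n = A'.a n := fun n =>
    sub_eq_zero.1 <| Normalized.eq_zero (g := A.a - A'.a) (sub_mem A.norm_a A'.norm_a)
      (fun n => by
        simp only [Pi.sub_apply]
        linear_combination A.a_eq n - A'.a_eq n + (u n).1 * hc n - (u n).2 * hb (n + 1)) n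
  funext n
  refine Prod.ext ?_ ?_
  · rw [A.fst_eq, A'.fst_eq, ha, hb]
  · rw [A.snd_eq, A'.snd_eq, ha, hc]

lemma rapidDecay (u : Phase) (v : RapidVec) {D : LaxData θ u.1 h w} (A : LaxDer D v.1 d) :
    RapidDecay d := by
  have hb : Rapid A.b := by
    rw [funext A.b_eq]
    exact (v.fst.neg.mul (Normalized.bdd D.norm_t)).sub
      (u.rapid_fst.mul (Normalized.bdd A.norm_t))
  have hc : Rapid A.c := by
    rw [funext A.c_eq']
    exact ((v.snd.shift (-1)).neg.mul (Normalized.bdd D.norm_t)).sub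
      ((u.rapid_snd.shift (-1)).mul (Normalized.bdd A.norm_t))
  refine rapidDecay_iff.2 ⟨?_, ?_⟩
  · rw [funext A.fst_eq]
    exact ((v.fst.mul ((Normalized.bdd D.norm_a).shift 1)).add
      (u.rapid_fst.mul ((Normalized.bdd A.norm_a).shift 1))).add (hb.shift 1)
  · rw [funext A.snd_eq]
    exact ((v.snd.neg.mul (Normalized.bdd D.norm_a)).sub
      (u.rapid_snd.mul (Normalized.bdd A.norm_a))).sub hc

end LaxDer

/-! ### The recursion operator is hereditary -/

/-- The vanishing of the Nijenhuis torsion, in terms of zero curvature data: the matrix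
`∂_{LX} N_Y - ∂_{LY} N_X + [N_Y, N_X] - z² (∂_X N_Y - ∂_Y N_X) - N_Z` vanishes. -/
theorem LaxData.torsion_eq_zero (u : Phase) (X Y : RapidVec) {LX LY XY YX LXY LYX LZ : Vec}
    (DX : LaxData θ u.1 X.1 LX) (DY : LaxData θ u.1 Y.1 LY)
    (A : LaxDer DY X.1 XY) (B : LaxDer DX Y.1 YX)
    (A' : LaxDer DY LX LXY) (B' : LaxDer DX LY LYX)
    (DZ : LaxData θ u.1 (XY - YX) LZ) : LXY - LYX = LZ := by
  have hbX := DX.rapid_b u X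
  have hcX := DX.rapid_c u X
  have hbY := DY.rapid_b u Y
  have hcY := DY.rapid_c u Y
  have hγ : ∀ n, 1 - (u.1 n).1 * (u.1 n).2 ≠ 0 := u.gammaSq_ne_zero
  -- The matrix is treated by descending powers of `z`, starting with the `z⁴` entry. Diagonal
  -- entries vanish because their differences do; off-diagonal ones follow algebraically.
  have ht : ∀ n, A.t n = B.t n := fun n => by
    refine sub_eq_zero.1 <| Normalized.eq_zero (g := A.t - B.t) (sub_mem A.norm_t B.norm_t)
      (fun n => mul_left_cancel₀ (hγ n) ?_) n
    simp only [Pi.sub_apply]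
    linear_combination A.t_eq n - B.t_eq n - (DY.t (n + 1) - DY.t n) * DX.t_eq n +
      (DX.t (n + 1) - DX.t n) * DY.t_eq n
  have hq3 : ∀ n, B.b n - A.b n + DY.b n * DX.t n - DX.b n * DY.t n = 0 := fun n => by
    linear_combination B.b_eq n - A.b_eq n + DX.t n * DY.b_eq n - DY.t n * DX.b_eq n +
      (u.1 n).1 * ht n
  have hr3 : ∀ n, B.c n - A.c n + DY.t n * DX.c n - DX.t n * DY.c n = 0 :=
    forall_of_forall_succ fun n => by
      linear_combination B.c_eq n - A.c_eq n + DY.t (n + 1) * DX.c_eq n -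
        DX.t (n + 1) * DY.c_eq n + (u.1 n).2 * ht (n + 1)
  -- The `z²` part of the `(1,1)` entry, after the `z³` entries `hq3` and `hr3`.
  have hp2 : ∀ n, B.a n - A.a n + DY.b n * DX.c n - DX.b n * DY.c n = 0 := fun n => by
    refine Normalized.eq_zero
      (g := B.a - A.a + (fun n => DY.b n * DX.c n) - fun n => DX.b n * DY.c n)
      (sub_mem (add_mem (sub_mem B.norm_a A.norm_a) (hbY.mul hcX.bdd).normalized)
        (hbX.mul hcY.bdd).normalized) (fun n => ?_) n
    simp only [Pi.sub_apply, Pi.add_apply]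
    linear_combination B.a_eq n - A.a_eq n + DY.b (n + 1) * DX.c_eq n -
      DX.b (n + 1) * DY.c_eq n - DX.c n * DY.b_eq n + DY.c n * DX.b_eq n +
      (u.1 n).1 * hr3 n - (u.1 n).2 * hq3 (n + 1)
  have hZ1 : ∀ n, ((XY - YX) n).1 = (XY n).1 - (YX n).1 := fun n => rfl
  have hZ2 : ∀ n, ((XY - YX) n).2 = (XY n).2 - (YX n).2 := fun n => rfl
  -- The `z¹` entries are first expressed through the `z²` part of the `(2,2)` entry, just as `b_eq`
  -- and `c_eq` do with `h = 0`; this closes a homogeneous equation for that entry, solved in `hv2`.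
  have hq1 : ∀ n, A'.b n - B'.b n + DY.a n * DX.b n - DX.a n * DY.b n - DZ.b n =
      -(u.1 n).1 * (A'.t n - B'.t n + DY.c n * DX.b n - DX.c n * DY.b n - DZ.t n) := fun n => by
    linear_combination A'.b_eq n - B'.b_eq n - DZ.b_eq n - hZ1 n - A.fst_eq n + B.fst_eq n -
      DY.t n * DX.fst_eq n + DX.t n * DY.fst_eq n + DY.a (n + 1) * DX.b_eq n -
      DX.a (n + 1) * DY.b_eq n + (u.1 n).1 * hp2 (n + 1) + hq3 (n + 1) -
      DX.b n * DY.a_eq n + DY.b n * DX.a_eq n + DX.b (n + 1) * DY.t_eq' n -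
      DY.b (n + 1) * DX.t_eq' n
  have hr1 : ∀ n, A'.c (n + 1) - B'.c (n + 1) + DY.c (n + 1) * DX.a (n + 1) -
      DX.c (n + 1) * DY.a (n + 1) - DZ.c (n + 1) =
      -(u.1 n).2 * (A'.t (n + 1) - B'.t (n + 1) + DY.c (n + 1) * DX.b (n + 1) -
        DX.c (n + 1) * DY.b (n + 1) - DZ.t (n + 1)) := fun n => by
    linear_combination A'.c_eq n - B'.c_eq n - DZ.c_eq n + hZ2 n + A.snd_eq n - B.snd_eq n -
      DY.t (n + 1) * DX.snd_eq n + DX.t (n + 1) * DY.snd_eq n + (u.1 n).2 * hp2 n + hr3 n -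
      DY.a n * DX.c_eq n + DX.a n * DY.c_eq n + DY.c (n + 1) * DX.a_eq n -
      DX.c (n + 1) * DY.a_eq n + DX.c n * DY.t_eq' n - DY.c n * DX.t_eq' n
  have hv2 : ∀ n, A'.t n - B'.t n + DY.c n * DX.b n - DX.c n * DY.b n - DZ.t n = 0 :=
    fun n => by
    refine Normalized.eq_zero
      (g := A'.t - B'.t + (fun n => DY.c n * DX.b n) - (fun n => DX.c n * DY.b n) - DZ.t)
      (sub_mem (sub_mem (add_mem (sub_mem A'.norm_t B'.norm_t) (hcY.mul hbX.bdd).normalized)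
        (hcX.mul hbY.bdd).normalized) DZ.norm_t) (fun n => mul_left_cancel₀ (hγ n) ?_) n
    simp only [Pi.sub_apply, Pi.add_apply]
    linear_combination A'.t_eq' n - B'.t_eq' n - DZ.t_eq' n + (u.1 n).2 * hq1 n -
      (u.1 n).1 * hr1 n - DY.c (n + 1) * DX.fst_eq n + DX.c (n + 1) * DY.fst_eq n +
      DY.b n * DX.snd_eq n - DX.b n * DY.snd_eq n
  have hq : ∀ n, A'.b n - B'.b n + DY.a n * DX.b n - DX.a n * DY.b n - DZ.b n = 0 :=
    fun n => by rw [hq1, hv2, mul_zero]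
  have hr : ∀ n, A'.c n - B'.c n + DY.c n * DX.a n - DX.c n * DY.a n - DZ.c n = 0 :=
    forall_of_forall_succ fun n => by rw [hr1, hv2, mul_zero]
  -- At order `z⁰` the products of the bounded entries `a` cancel in the commutator.
  have hp0 : ∀ n, A'.a n - B'.a n - DZ.a n = 0 := fun n => by
    refine Normalized.eq_zero (g := A'.a - B'.a - DZ.a)
      (sub_mem (sub_mem A'.norm_a B'.norm_a) DZ.norm_a) (fun n => ?_) n
    simp only [Pi.sub_apply]
    linear_combination A'.a_eq n - B'.a_eq n - DZ.a_eq n + (u.1 n).1 * hr n -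
      (u.1 n).2 * hq (n + 1) + DY.c n * DX.fst_eq n - DX.c n * DY.fst_eq n -
      DY.b (n + 1) * DX.snd_eq n + DX.b (n + 1) * DY.snd_eq n -
      (DX.a (n + 1) - DX.a n) * DY.a_eq n + (DY.a (n + 1) - DY.a n) * DX.a_eq n
  funext n
  refine Prod.ext ?_ ?_
  · change (LXY n).1 - (LYX n).1 = _
    linear_combination A'.fst_eq n - B'.fst_eq n - DZ.fst_eq n + (u.1 n).1 * hp0 (n + 1) +
      hq (n + 1) +
      DY.a (n + 1) * DX.fst_eq n - DX.a (n + 1) * DY.fst_eq n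
  · change (LXY n).2 - (LYX n).2 = _
    linear_combination A'.snd_eq n - B'.snd_eq n - DZ.snd_eq n - (u.1 n).2 * hp0 n -
      hr n - DY.a n * DX.snd_eq n + DX.a n * DY.snd_eq n

end

section

open Filter Topology

lemma Rapid.shift_pred {f : ℤ → ℂ} (hf : Rapid f) : Rapid fun n => f (n - 1) := hf.shift (-1)

lemma RapidJet.shift_pred {c : ℝ → ℤ → ℂ} {a b : ℤ → ℂ} (h : RapidJet c a b) :
    RapidJet (fun ε n => c ε (n - 1)) (fun n => a (n - 1)) fun n => b (n - 1) := h.shift (-1)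

lemma RapidJet.of_eq {c : ℝ → ℤ → ℂ} {a b a' b' : ℤ → ℂ} (h : RapidJet c a b)
    (ha : a = a') (hb : b = b') : RapidJet c a' b' := ha ▸ hb ▸ h

variable (θ : ℂ)

/-! ### The recursion operator on rapidly decreasing sequences -/

section Data

variable (u : Phase) (h : RapidVec)

lemma rapid_nonlocal_arg :
    Rapid fun n => ((u.1 n).2 * (h.1 n).1 + (u.1 n).1 * (h.1 n).2) / gammaSq u.1 n := by
  simp only [div_eq_mul_inv]
  exact ((h.fst.mul_left u.rapid_snd.bdd).add (h.snd.mul_left u.rapid_fst.bdd)).mul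
    u.bdd_inv_gammaSq

lemma rapid_local_arg :
    Rapid fun n => (u.1 n).2 * (h.1 (n + 1)).1 + (u.1 n).1 * (h.1 (n - 1)).2 :=
  ((h.fst.shift 1).mul_left u.rapid_snd.bdd).add (h.snd.shift_pred.mul_left u.rapid_fst.bdd)

lemma nonlocalGamma_normalized : nonlocalGamma θ u.1 h.1 ∈ Normalized θ :=
  (rapid_nonlocal_arg u h).invDiff_normalized

/-- The zero curvature data of the recursion operator. -/
def laxData : LaxData θ u.1 h.1 (opL θ u.1 h.1) where
  -- In `Q_n c_n - R_n b_{n+1}` the terms containing `t` form the exact difference of `Q_n R_{n-1}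
  -- t_n`; the rest is minus the density of the local sum.
  a n := -invDiff θ (fun n => (u.1 n).2 * (h.1 (n + 1)).1 + (u.1 n).1 * (h.1 (n - 1)).2) n +
    (u.1 n).1 * (u.1 (n - 1)).2 * nonlocalGamma θ u.1 h.1 n
  b n := (h.1 n).1 - (u.1 n).1 * nonlocalGamma θ u.1 h.1 n
  c n := -(h.1 (n - 1)).2 - (u.1 (n - 1)).2 * nonlocalGamma θ u.1 h.1 n
  t := nonlocalGamma θ u.1 h.1
  norm_a := add_mem (neg_mem (rapid_local_arg u h).invDiff_normalized)
    ((u.rapid_fst.mul u.rapid_snd.shift_pred.bdd).mul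
      (Normalized.bdd (nonlocalGamma_normalized θ u h))).normalized
  norm_t := nonlocalGamma_normalized θ u h
  b_eq n := rfl
  c_eq n := by rw [add_sub_cancel_right]
  t_eq n := by
    have := invDiff_succ_sub θ (rapid_nonlocal_arg u h).decay2 n
    rw [eq_div_iff (u.gammaSq_ne_zero n)] at this
    rw [← this, mul_comm]
    rfl
  a_eq n := by
    have := invDiff_succ_sub θ (rapid_local_arg u h).decay2 n
    rw [add_sub_cancel_right]
    linear_combination -this
  fst_eq n := by
    simp only [opL, gammaSq, add_sub_cancel_right]
    ring
  snd_eq n := by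
    simp only [opL, gammaSq]
    ring

lemma rapidDecay_opL : RapidDecay (opL θ u.1 h.1) := (laxData θ u h).rapidDecay u h

/-- The zero curvature relation read backwards: the two nonlocal terms of `L⁻¹` at `w = L h` are
`-a` and `t_n - R_n Q_{n-1} a_n`, so the roles of `a` and `t` are exchanged. -/
lemma opLInv_opL : opLInv θ u.1 (opL θ u.1 h.1) = h.1 := by
  have D := laxData θ u h
  set w := opL θ u.1 h.1
  have ht : nonlocalGamma θ u.1 w = -D.a := by
    refine Normalized.eq_invDiff (neg_mem D.norm_a) fun n => ?_
    rw [eq_div_iff (u.gammaSq_ne_zero n)]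
    simp only [Pi.neg_apply, gammaSq]
    linear_combination -(u.1 n).2 * D.fst_eq n - (u.1 n).1 * D.snd_eq n - D.a_eq n
  have hs : invDiff θ (fun n => (u.1 n).2 * (w (n - 1)).1 + (u.1 n).1 * (w (n + 1)).2) =
      D.t - fun n => (u.1 n).2 * (u.1 (n - 1)).1 * D.a n := by
    refine Normalized.eq_invDiff (sub_mem D.norm_t ((u.rapid_snd.mul
      u.rapid_fst.shift_pred.bdd).mul (Normalized.bdd D.norm_a)).normalized) fun n => ?_
    have h1 := D.fst_eq (n - 1)
    rw [sub_add_cancel] at h1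
    simp only [Pi.sub_apply, add_sub_cancel_right]
    linear_combination D.t_eq' n - (u.1 n).2 * h1 - (u.1 n).1 * D.snd_eq (n + 1)
  funext n
  refine Prod.ext ?_ ?_
  · have h1 := D.fst_eq (n - 1)
    rw [sub_add_cancel] at h1
    simp only [opLInv, hs, ht, Pi.neg_apply, Pi.sub_apply, gammaSq]
    linear_combination h1 + D.b_eq n
  · simp only [opLInv, hs, ht, Pi.neg_apply, Pi.sub_apply, gammaSq, add_sub_cancel_right]
    linear_combination D.snd_eq (n + 1) - D.c_eq n

end Data

/-- Exchange of the two components. -/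
def swapVec (h : Vec) : Vec := fun n => (h n).swap

@[simp] lemma swapVec_swapVec (h : Vec) : swapVec (swapVec h) = h := rfl

lemma rapidDecay_swapVec {h : Vec} (hh : RapidDecay h) : RapidDecay (swapVec h) :=
  rapidDecay_iff.2 (rapidDecay_iff.1 hh).symm

/-- Exchange of the two potentials. -/
def Phase.swap (u : Phase) : Phase :=
  ⟨swapVec u.1, rapidDecay_swapVec u.2.1, fun n => by
    have := u.2.2 n
    rwa [mul_comm] at this⟩

/-- Interchanging `Q` and `R` carries `L` to `L⁻¹`, so statements about `L⁻¹` need no separate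
computation. -/
lemma opLInv_eq_swap (u h : Vec) : opLInv θ u h = swapVec (opL θ (swapVec u) (swapVec h)) := by
  have hγ : gammaSq (swapVec u) = gammaSq u := by
    funext n; simp [gammaSq, swapVec, mul_comm]
  have ht : nonlocalGamma θ (swapVec u) (swapVec h) = nonlocalGamma θ u h := by
    unfold nonlocalGamma
    rw [hγ]
    simp only [swapVec, Prod.fst_swap, Prod.snd_swap, add_comm]
  have hs : (fun n => (u n).2 * (h (n - 1)).1 + (u n).1 * (h (n + 1)).2) =
      fun n => (swapVec u n).2 * (swapVec h (n + 1)).1 +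
        (swapVec u n).1 * (swapVec h (n - 1)).2 := by
    funext n
    simp only [swapVec, Prod.fst_swap, Prod.snd_swap, add_comm]
  unfold opLInv opL
  rw [hs, ht, hγ]
  rfl

lemma opL_eq_swap (u h : Vec) : opL θ u h = swapVec (opLInv θ (swapVec u) (swapVec h)) := by
  rw [opLInv_eq_swap]
  simp only [swapVec_swapVec]

lemma rapidDecay_opLInv (u : Phase) (h : RapidVec) : RapidDecay (opLInv θ u.1 h.1) := by
  rw [opLInv_eq_swap]
  exact rapidDecay_swapVec (rapidDecay_opL θ u.swap ⟨_, rapidDecay_swapVec h.2⟩)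

lemma opL_opLInv (u : Phase) (h : RapidVec) : opL θ u.1 (opLInv θ u.1 h.1) = h.1 := by
  have hw := opLInv_eq_swap θ u.1 h.1
  rw [opL_eq_swap, hw, swapVec_swapVec]
  have := opLInv_opL θ u.swap ⟨_, rapidDecay_swapVec h.2⟩
  exact congrArg swapVec this

/-- The recursion operator as an automorphism of the rapidly decreasing sequences. -/
def recOp (u : Phase) : RapidVec ≃ₗ[ℂ] RapidVec where
  toFun h := ⟨opL θ u.1 h.1, rapidDecay_opL θ u h⟩
  invFun h := ⟨opLInv θ u.1 h.1, rapidDecay_opLInv θ u h⟩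
  left_inv h := Subtype.ext (opLInv_opL θ u h)
  right_inv h := Subtype.ext (opL_opLInv θ u h)
  map_add' h h' := Subtype.ext <|
    (laxData θ u (h + h')).unique u.gammaSq_ne_zero ((laxData θ u h).add (laxData θ u h'))
  map_smul' z h := Subtype.ext <|
    (laxData θ u (z • h)).unique u.gammaSq_ne_zero ((laxData θ u h).smul z)

lemma coe_recOp (u : Phase) (h : RapidVec) : (recOp θ u h).1 = opL θ u.1 h.1 := rfl

/-! ### The derivative of the recursion operator -/

section Derivative

variable (u : Phase) (v h : RapidVec)

/-- The density of the derivative of `(E - 1)⁻¹ (R_n, Q_n) γ_n⁻² h`. -/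
def nonlocalDerArg (u v h : Vec) (n : ℤ) : ℂ :=
  ((v n).2 * (h n).1 + (v n).1 * (h n).2) * (gammaSq u n)⁻¹ -
    ((u n).2 * (h n).1 + (u n).1 * (h n).2) *
      (Phase.gammaDer u v n * (gammaSq u n)⁻¹ * (gammaSq u n)⁻¹)

/-- The density of the derivative of the local sum in `L`. -/
def localDerArg (v h : Vec) (n : ℤ) : ℂ := (v n).2 * (h (n + 1)).1 + (v n).1 * (h (n - 1)).2

/-- The derivative of the recursion operator in the direction `v`. -/
def opLDer (u v h : Vec) : Vec :=
  let s := invDiff θ fun n => (u n).2 * (h (n + 1)).1 + (u n).1 * (h (n - 1)).2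
  let t := nonlocalGamma θ u h
  let s' := invDiff θ (localDerArg v h)
  let t' := invDiff θ (nonlocalDerArg u v h)
  fun n =>
    (-((v n).1 * s (n + 1) + (u n).1 * s' (n + 1)) -
      (Phase.gammaDer u v n * ((u (n + 1)).1 * t (n + 1)) +
        gammaSq u n * ((v (n + 1)).1 * t (n + 1) + (u (n + 1)).1 * t' (n + 1))),
     ((v n).2 * s n + (u n).2 * s' n) +
      (Phase.gammaDer u v n * ((u (n - 1)).2 * t n) +
        gammaSq u n * ((v (n - 1)).2 * t n + (u (n - 1)).2 * t' n)))

lemma rapid_localDerArg : Rapid (localDerArg v.1 h.1) :=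
  (v.snd.mul (h.fst.shift 1).bdd).add (v.fst.mul h.snd.shift_pred.bdd)

lemma rapid_gammaDer : Rapid (Phase.gammaDer u.1 v.1) :=
  ((v.fst.mul u.rapid_snd.bdd).add (v.snd.mul_left u.rapid_fst.bdd)).neg

lemma rapid_nonlocalDerArg : Rapid (nonlocalDerArg u.1 v.1 h.1) :=
  (((v.snd.mul h.fst.bdd).add (v.fst.mul h.snd.bdd)).mul u.bdd_inv_gammaSq).sub
    (((h.fst.mul_left u.rapid_snd.bdd).add (h.snd.mul_left u.rapid_fst.bdd)).mul
      (((rapid_gammaDer u v).mul u.bdd_inv_gammaSq).mul u.bdd_inv_gammaSq).bdd)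

/-- The derivative of the zero curvature data of the recursion operator. -/
def laxDer : LaxDer (laxData θ u h) v.1 (opLDer θ u.1 v.1 h.1) where
  a n := -invDiff θ (localDerArg v.1 h.1) n +
    ((v.1 n).1 * (u.1 (n - 1)).2 + (u.1 n).1 * (v.1 (n - 1)).2) * nonlocalGamma θ u.1 h.1 n +
    (u.1 n).1 * (u.1 (n - 1)).2 * invDiff θ (nonlocalDerArg u.1 v.1 h.1) n
  b n := -(v.1 n).1 * nonlocalGamma θ u.1 h.1 n -
    (u.1 n).1 * invDiff θ (nonlocalDerArg u.1 v.1 h.1) n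
  c n := -(v.1 (n - 1)).2 * nonlocalGamma θ u.1 h.1 n -
    (u.1 (n - 1)).2 * invDiff θ (nonlocalDerArg u.1 v.1 h.1) n
  t := invDiff θ (nonlocalDerArg u.1 v.1 h.1)
  norm_a := add_mem (add_mem (neg_mem (rapid_localDerArg v h).invDiff_normalized)
    (((v.fst.mul u.rapid_snd.shift_pred.bdd).add
      (u.rapid_fst.mul v.snd.shift_pred.bdd)).mul
      (Normalized.bdd (nonlocalGamma_normalized θ u h))).normalized)
    ((u.rapid_fst.mul u.rapid_snd.shift_pred.bdd).mul
      ((rapid_nonlocalDerArg u v h).bdd_invDiff θ)).normalized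
  norm_t := (rapid_nonlocalDerArg u v h).invDiff_normalized
  b_eq n := rfl
  c_eq n := by simp only [add_sub_cancel_right]; rfl
  t_eq n := by
    have h1 := invDiff_succ_sub θ (rapid_nonlocalDerArg u v h).decay2 n
    have h2 : nonlocalGamma θ u.1 h.1 (n + 1) - nonlocalGamma θ u.1 h.1 n = _ :=
      invDiff_succ_sub θ (rapid_nonlocal_arg u h).decay2 n
    have h3 := u.gammaSq_ne_zero n
    change gammaSq u.1 n * _ = _ * (nonlocalGamma θ u.1 h.1 (n + 1) -
      nonlocalGamma θ u.1 h.1 n) + _ + _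
    rw [h1, h2, nonlocalDerArg, Phase.gammaDer]
    field_simp
    ring
  a_eq n := by
    have h1 : _ = (v.1 n).2 * (h.1 (n + 1)).1 + (v.1 n).1 * (h.1 (n - 1)).2 :=
      invDiff_succ_sub θ (rapid_localDerArg v h).decay2 n
    simp only [laxData, add_sub_cancel_right]
    linear_combination -h1
  fst_eq n := by
    simp only [opLDer, laxData, gammaSq, Phase.gammaDer, add_sub_cancel_right]
    ring
  snd_eq n := by
    simp only [opLDer, laxData, gammaSq, Phase.gammaDer]
    ring

/-- The derivative of the recursion operator, as a linear function of the direction. -/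
def recOpDer (u : Phase) (h : RapidVec) : RapidVec →ₗ[ℂ] RapidVec where
  toFun v := ⟨opLDer θ u.1 v.1 h.1, (laxDer θ u v h).rapidDecay u v⟩
  map_add' v v' := Subtype.ext <|
    (laxDer θ u (v + v') h).unique u.gammaSq_ne_zero ((laxDer θ u v h).add (laxDer θ u v' h))
  map_smul' z v := Subtype.ext <|
    (laxDer θ u (z • v) h).unique u.gammaSq_ne_zero ((laxDer θ u v h).smul z)

/-- Heredity: `L'[LX]Y - L'[LY]X = L (L'[X]Y - L'[Y]X)`. In `recOpDer θ u h v` the derivative of `L`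
in the direction `v` acts on `h`. -/
lemma recOpDer_torsion (u : Phase) (X Y : RapidVec) :
    recOpDer θ u Y (recOp θ u X) - recOpDer θ u X (recOp θ u Y) =
      recOp θ u (recOpDer θ u Y X - recOpDer θ u X Y) :=
  Subtype.ext <| LaxData.torsion_eq_zero u X Y (laxData θ u X) (laxData θ u Y)
    (laxDer θ u X Y) (laxDer θ u Y X) (laxDer θ u (recOp θ u X) Y)
    (laxDer θ u (recOp θ u Y) X) (laxData θ u (recOpDer θ u Y X - recOpDer θ u X Y))

variable {H : ℝ → Vec} {h h' : RapidVec}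

lemma jet_nonlocalGamma (hH : VecJet H h.1 h'.1) :
    Jet 0 (fun ε => nonlocalGamma θ (u.1 + ε • v.1) (H ε)) (nonlocalGamma θ u.1 h.1)
      fun n => invDiff θ (nonlocalDerArg u.1 v.1 h.1) n + nonlocalGamma θ u.1 h'.1 n := by
  have hU := u.jet_line v
  have h1 := (((hU.snd.mul hH.fst.bdd).add (hU.fst.mul hH.snd.bdd)).mul
    (u.jet_inv_gammaSq v)).invDiff θ
  refine h1.of_eq rfl ?_
  refine Eq.trans ?_ (invDiff_add θ (rapid_nonlocalDerArg u v h).decay2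
    (rapid_nonlocal_arg u h').decay2)
  congr 1
  funext n
  simp only [nonlocalDerArg]
  ring

lemma jet_localSum (hH : VecJet H h.1 h'.1) :
    Jet 0 (fun ε => invDiff θ fun n => ((u.1 + ε • v.1) n).2 * (H ε (n + 1)).1 +
        ((u.1 + ε • v.1) n).1 * (H ε (n - 1)).2)
      (invDiff θ fun n => (u.1 n).2 * (h.1 (n + 1)).1 + (u.1 n).1 * (h.1 (n - 1)).2)
      fun n => invDiff θ (localDerArg v.1 h.1) n +
        invDiff θ (fun n => (u.1 n).2 * (h'.1 (n + 1)).1 + (u.1 n).1 * (h'.1 (n - 1)).2) n := by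
  have hU := u.jet_line v
  have h1 := ((hU.snd.mul (hH.fst.shift 1).bdd).add (hU.fst.mul hH.snd.shift_pred.bdd)).invDiff θ
  refine h1.of_eq rfl ?_
  refine Eq.trans ?_ (invDiff_add θ (rapid_localDerArg v h).decay2
    (rapid_local_arg u h').decay2)
  congr 1
  funext n
  simp only [localDerArg]
  ring

/-- The product rule, with remainder in every weight; keeping all weights is what allows `L` to be
iterated. -/
lemma jet_opL (hH : VecJet H h.1 h'.1) :
    VecJet (fun ε => opL θ (u.1 + ε • v.1) (H ε)) (opL θ u.1 h.1)
      (opLDer θ u.1 v.1 h.1 + opL θ u.1 h'.1) := by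
  have hU := u.jet_line v
  have hs := jet_localSum θ u v hH
  have ht := jet_nonlocalGamma θ u v hH
  have hγ := u.jet_gammaSq v
  constructor
  · refine (((hH.fst.shift 1).sub (hU.fst.mul (hs.shift 1))).sub
      (fun k => (hγ.mul (((hU.fst.shift 1).mul (ht.shift 1)) k)).mono (by omega))).of_eq rfl ?_
    funext n
    simp only [Pi.add_apply, Prod.fst_add, opLDer, opL]
    ring
  · refine ((hH.snd.shift_pred.add (hU.snd.mul hs)).add
      (fun k => (hγ.mul ((hU.snd.shift_pred.mul ht) k)).mono (by omega))).of_eq rfl ?_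
    funext n
    simp only [Pi.add_apply, Prod.snd_add, opLDer, opL]
    ring

end Derivative

end

section

open Filter Topology

/-! ### Differentiable vector fields with rapidly decreasing values -/

namespace VecJet

variable {c d : ℝ → Vec} {a b a' b' : Vec}

lemma add (h : VecJet c a b) (h' : VecJet d a' b') :
    VecJet (fun ε => c ε + d ε) (a + a') (b + b') :=
  ⟨h.fst.add h'.fst, h.snd.add h'.snd⟩

lemma smul (z : ℂ) (h : VecJet c a b) : VecJet (fun ε => z • c ε) (z • a) (z • b) := by
  have hz := Jet.const (IsBig.const z)
  constructor
  · refine fun k => ((h.fst.mul hz) k |>.congr (Eventually.of_forall fun ε => ?_)).of_eq ?_ ?_ <;>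
      funext n <;> simp [mul_comm]
  · refine fun k => ((h.snd.mul hz) k |>.congr (Eventually.of_forall fun ε => ?_)).of_eq ?_ ?_ <;>
      funext n <;> simp [mul_comm]

lemma swap (h : VecJet c a b) : VecJet (fun ε => swapVec (c ε)) (swapVec a) (swapVec b) :=
  ⟨h.snd, h.fst⟩

end VecJet

/-- Vector fields with rapidly decreasing values. -/
abbrev RapidField : Type := Phase → RapidVec

/-- The underlying vector field. -/
def toField : RapidField →ₗ[ℂ] VectorField where
  toFun F u := (F u).1
  map_add' _ _ := rfl
  map_smul' _ _ := rfl

/-- The curve `ε ↦ F(u + ε v)`. -/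
def along (F : RapidField) (u : Phase) (v : RapidVec) (ε : ℝ) : Vec :=
  Function.extend Subtype.val (toField F) 0 (u.1 + ε • v.1)

lemma eventually_along (u : Phase) (v : RapidVec) : ∀ᶠ ε in 𝓝 (0 : ℝ), ∃ w : Phase,
    w.1 = u.1 + ε • v.1 ∧ ∀ F : RapidField, along F u v ε = (F w).1 := by
  filter_upwards [u.eventually_mem v] with ε ⟨w, hw⟩
  refine ⟨w, hw, fun F => ?_⟩
  rw [along, ← hw]
  exact Subtype.val_injective.extend_apply _ _ _

/-- `D` is the derivative of `F` at `u`. -/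
def IsDer (F : RapidField) (u : Phase) (D : RapidVec →ₗ[ℂ] RapidVec) : Prop :=
  ∀ v, VecJet (along F u v) (F u).1 (D v).1

namespace IsDer

variable {F G : RapidField} {u : Phase} {D D' : RapidVec →ₗ[ℂ] RapidVec}

lemma unique (h : IsDer F u D) (h' : IsDer F u D') : D = D' :=
  LinearMap.ext fun v => Subtype.ext ((h v).unique_der (h' v))

lemma add (h : IsDer F u D) (h' : IsDer G u D') : IsDer (F + G) u (D + D') := fun v =>
  ((h v).add (h' v)).congr (by
    filter_upwards [eventually_along u v] with ε ⟨w, _, hw⟩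
    rw [hw, hw, hw]
    rfl)

lemma smul (z : ℂ) (h : IsDer F u D) : IsDer (z • F) u (z • D) := fun v =>
  ((h v).smul z).congr (by
    filter_upwards [eventually_along u v] with ε ⟨w, _, hw⟩
    rw [hw, hw]
    rfl)

lemma zero : IsDer 0 u 0 := fun v => by
  refine VecJet.congr (c := fun _ => 0) ⟨fun k => ?_, fun k => ?_⟩ ?_
  · exact Jet.const (rapid_zero k)
  · exact Jet.const (rapid_zero k)
  · filter_upwards [eventually_along u v] with ε ⟨w, _, hw⟩
    rw [hw]
    rfl

lemma recOp (θ : ℂ) (h : IsDer F u D) : IsDer (fun u => recOp θ u (F u)) u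
    (recOpDer θ u (F u) + (recOp θ u : RapidVec →ₗ[ℂ] RapidVec) ∘ₗ D) := fun v =>
  (jet_opL θ u v (h v)).congr (by
    filter_upwards [eventually_along u v] with ε ⟨w, hw', hw⟩
    rw [hw, hw, ← hw', coe_recOp])

/-- Differentiability of `L⁻¹ F` comes from conjugating `L` by the swap; the value of the derivative
then comes from differentiating `L (L⁻¹ F) = F`. -/
lemma recOp_symm (θ : ℂ) (h : IsDer F u D) : IsDer (fun u => (DAKNS.recOp θ u).symm (F u)) u
    (((DAKNS.recOp θ u).symm : RapidVec →ₗ[ℂ] RapidVec) ∘ₗ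
      (D - recOpDer θ u ((DAKNS.recOp θ u).symm (F u)))) := fun v => by
  set G : RapidField := fun u => (DAKNS.recOp θ u).symm (F u) with hG
  have hsw (x : RapidVec) : RapidDecay (swapVec x.1) := rapidDecay_swapVec x.2
  obtain ⟨d, hd⟩ : ∃ d : RapidVec, VecJet (along G u v) (G u).1 d.1 := by
    have h1 := (jet_opL θ u.swap ⟨_, hsw v⟩ (h := ⟨_, hsw (F u)⟩) (h' := ⟨_, hsw (D v)⟩)
      (h v).swap).swap
    refine ⟨⟨_, rapidDecay_swapVec (recOpDer θ u.swap ⟨_, hsw (F u)⟩ ⟨_, hsw v⟩ +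
      DAKNS.recOp θ u.swap ⟨_, hsw (D v)⟩).2⟩, ?_⟩
    have h2 : (G u).1 = swapVec (opL θ u.swap.1 (swapVec (F u).1)) := opLInv_eq_swap θ _ _
    rw [h2]
    refine h1.congr ?_
    filter_upwards [eventually_along u v] with ε ⟨w, hw', hw⟩
    rw [hw, hw]
    change _ = opLInv θ w.1 (F w).1
    rw [opLInv_eq_swap, hw']
    rfl
  have h3 : VecJet (along F u v) _ _ := (jet_opL θ u v hd).congr (by
    filter_upwards [eventually_along u v] with ε ⟨w, hw', hw⟩
    rw [hw, hw, ← hw']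
    exact opL_opLInv θ w (F w))
  have h4 : D v = recOpDer θ u (G u) v + DAKNS.recOp θ u d :=
    Subtype.ext ((h v).unique_der h3)
  have h5 : (DAKNS.recOp θ u).symm (D v - recOpDer θ u (G u) v) = d := by
    rw [h4, add_sub_cancel_left, LinearEquiv.symm_apply_apply]
  change VecJet _ _ ((DAKNS.recOp θ u).symm (D v - recOpDer θ u (G u) v)).1
  rw [h5]
  exact hd

end IsDer

/-- The rapidly decreasing vector fields that are differentiable with complex linear derivative. -/
def Regular : Submodule ℂ RapidField where
  carrier := {F | ∃ D : Phase → RapidVec →ₗ[ℂ] RapidVec, ∀ u, IsDer F u (D u)}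
  zero_mem' := ⟨0, fun _ => IsDer.zero⟩
  add_mem' := by
    rintro F G ⟨D, h⟩ ⟨D', h'⟩
    exact ⟨D + D', fun u => (h u).add (h' u)⟩
  smul_mem' := by
    rintro z F ⟨D, h⟩
    exact ⟨z • D, fun u => (h u).smul z⟩

/-- The derivative of a regular vector field. -/
def der (F : Regular) : Phase → RapidVec →ₗ[ℂ] RapidVec := F.2.choose

lemma isDer_der (F : Regular) (u : Phase) : IsDer F.1 u (der F u) := F.2.choose_spec u

lemma der_eq {F : Regular} {u : Phase} {D : RapidVec →ₗ[ℂ] RapidVec} (h : IsDer F.1 u D) :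
    der F u = D := (isDer_der F u).unique h

lemma der_add (F G : Regular) (u : Phase) : der (F + G) u = der F u + der G u :=
  der_eq ((isDer_der F u).add (isDer_der G u))

lemma der_smul (z : ℂ) (F : Regular) (u : Phase) : der (z • F) u = z • der F u :=
  der_eq ((isDer_der F u).smul z)

lemma hasDerivAt_alongLine (F G : Regular) (u : Phase) (n : ℤ) :
    HasDerivAt (alongLine (toField F.1) u (toField G.1 u) n) ((der F u (G.1 u)).1 n) 0 :=
  (isDer_der F u (G.1 u)).hasDerivAt n

/-- The Lie product of regular vector fields. -/
def lieProd : Regular →ₗ[ℂ] Regular →ₗ[ℂ] RapidField :=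
  LinearMap.mk₂ ℂ (fun F G u => der F u (G.1 u) - der G u (F.1 u))
    (fun F F' G => by
      funext u
      simp only [der_add, Submodule.coe_add, Pi.add_apply, map_add, LinearMap.add_apply]
      abel)
    (fun z F G => by
      funext u
      simp only [der_smul, Submodule.coe_smul, Pi.smul_apply, map_smul, LinearMap.smul_apply,
        smul_sub])
    (fun F G G' => by
      funext u
      simp only [der_add, Submodule.coe_add, Pi.add_apply, map_add, LinearMap.add_apply]
      abel)
    (fun z F G => by
      funext u
      simp only [der_smul, Submodule.coe_smul, Pi.smul_apply, map_smul, LinearMap.smul_apply,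
        smul_sub])

lemma lieProd_apply (F G : Regular) (u : Phase) :
    lieProd F G u = der F u (G.1 u) - der G u (F.1 u) := rfl

lemma lieProd_swap (F G : Regular) : lieProd F G = -lieProd G F := by
  funext u
  simp only [lieProd_apply, Pi.neg_apply, neg_sub]

lemma bracket_toField (F G : Regular) :
    bracket (toField F.1) (toField G.1) = toField (lieProd F G) := by
  funext u n
  change deriv (alongLine (toField F.1) u (toField G.1 u) n) 0 -
    deriv (alongLine (toField G.1) u (toField F.1 u) n) 0 = _
  rw [(hasDerivAt_alongLine F G u n).deriv, (hasDerivAt_alongLine G F u n).deriv]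
  rfl

/-! ### Orbits of the recursion operator -/

variable (θ : ℂ)

/-- The recursion operator acting on regular vector fields. -/
def fieldOp : Regular ≃ₗ[ℂ] Regular where
  toFun F := ⟨fun u => recOp θ u (F.1 u), _, fun u => (isDer_der F u).recOp θ⟩
  invFun F := ⟨fun u => (recOp θ u).symm (F.1 u), _, fun u => (isDer_der F u).recOp_symm θ⟩
  left_inv _ := Subtype.ext <| funext fun u => (recOp θ u).symm_apply_apply _
  right_inv _ := Subtype.ext <| funext fun u => (recOp θ u).apply_symm_apply _
  map_add' _ _ := Subtype.ext <| funext fun u => (recOp θ u).map_add _ _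
  map_smul' _ _ := Subtype.ext <| funext fun u => (recOp θ u).map_smul _ _

lemma fieldOp_apply (F : Regular) (u : Phase) : (fieldOp θ F).1 u = recOp θ u (F.1 u) := rfl

lemma der_fieldOp (F : Regular) (u : Phase) (v : RapidVec) :
    der (fieldOp θ F) u v = recOpDer θ u (F.1 u) v + recOp θ u (der F u v) := by
  rw [der_eq (F := fieldOp θ F) ((isDer_der F u).recOp θ)]
  rfl

/-- Minus the Lie derivative of the recursion operator along `F`. -/
def lieOp (F : Regular) (u : Phase) (h : RapidVec) : RapidVec :=
  der F u (recOp θ u h) - recOp θ u (der F u h) - recOpDer θ u h (F.1 u)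

/-- Equivalent to heredity, applied to `h` and `F(u)`: the terms with `L'` combine into `L` of an
expression in `L'`. -/
lemma lieOp_fieldOp (F : Regular) (u : Phase) (h : RapidVec) :
    lieOp θ (fieldOp θ F) u h = recOp θ u (lieOp θ F u h) := by
  have := recOpDer_torsion θ u h (F.1 u)
  simp only [lieOp, der_fieldOp, fieldOp_apply, map_add, map_sub] at this ⊢
  rw [sub_eq_iff_eq_add] at this
  rw [this]
  abel

/-- Product rule for the Lie derivative of `L G`. -/
lemma lieProd_fieldOp (F G : Regular) (u : Phase) :
    lieProd F (fieldOp θ G) u = lieOp θ F u (G.1 u) + recOp θ u (lieProd F G u) := by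
  simp only [lieProd_apply, lieOp, der_fieldOp, fieldOp_apply, map_sub]
  abel

lemma zpow_fieldOp_apply (i : ℤ) (F : Regular) (u : Phase) :
    ((fieldOp θ ^ i) F).1 u = (recOp θ u ^ i) (F.1 u) := by
  induction i using Int.induction_on generalizing F with
  | zero => rfl
  | succ i ih => rw [zpow_add_one, zpow_add_one, LinearEquiv.mul_apply, ih]; rfl
  | pred i ih => rw [zpow_sub_one, zpow_sub_one, LinearEquiv.mul_apply, ih]; rfl

variable {θ}

lemma lieOp_zpow {F : Regular} {c : ℂ} (hF : ∀ u h, lieOp θ F u h = c • recOp θ u h)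
    (i : ℤ) (u : Phase) (h : RapidVec) :
    lieOp θ ((fieldOp θ ^ i) F) u h = c • (recOp θ u ^ (i + 1)) h := by
  induction i using Int.induction_on with
  | zero => simpa using hF u h
  | succ i ih =>
    rw [add_comm (i : ℤ) 1, zpow_one_add, LinearEquiv.mul_apply, lieOp_fieldOp, ih,
      map_smul, ← LinearEquiv.mul_apply, ← zpow_one_add]
    congr 3
  | pred i ih =>
    have h1 := lieOp_fieldOp θ ((fieldOp θ ^ (-(i : ℤ) - 1)) F) u h
    rw [← LinearEquiv.mul_apply, ← zpow_one_add, add_sub_cancel, ih] at h1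
    refine (recOp θ u).injective ?_
    rw [← h1, map_smul, ← LinearEquiv.mul_apply, ← zpow_one_add]
    congr 3
    ring

lemma lieProd_zpow_right {F : Regular} {c : ℂ} {i : ℤ}
    (hF : ∀ u h, lieOp θ F u h = c • (recOp θ u ^ (i + 1)) h) (G : Regular) (j : ℤ) (u : Phase) :
    lieProd F ((fieldOp θ ^ j) G) u =
      (c * j) • (recOp θ u ^ (i + j)) (G.1 u) + (recOp θ u ^ j) (lieProd F G u) := by
  -- As `L` is injective, the formulas at `j` and `j + 1` are equivalent, so induction runs in both
  -- directions from `j = 0`.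
  have key (j : ℤ) : (lieProd F ((fieldOp θ ^ (j + 1)) G) u =
      (c * (j + 1 : ℤ)) • (recOp θ u ^ (i + (j + 1))) (G.1 u) +
        (recOp θ u ^ (j + 1)) (lieProd F G u)) ↔
      (lieProd F ((fieldOp θ ^ j) G) u =
        (c * j) • (recOp θ u ^ (i + j)) (G.1 u) + (recOp θ u ^ j) (lieProd F G u)) := by
    have h1 : lieProd F ((fieldOp θ ^ (j + 1)) G) u =
        c • (recOp θ u ^ (i + (j + 1))) (G.1 u) +
          recOp θ u (lieProd F ((fieldOp θ ^ j) G) u) := by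
      rw [add_comm j 1, zpow_one_add, LinearEquiv.mul_apply, lieProd_fieldOp, hF,
        zpow_fieldOp_apply, ← LinearEquiv.mul_apply, ← zpow_add]
      congr 4
      ring
    have h2 : (recOp θ u ^ (i + (j + 1))) (G.1 u) =
        recOp θ u ((recOp θ u ^ (i + j)) (G.1 u)) := by
      rw [← LinearEquiv.mul_apply, ← zpow_one_add]
      congr 2
      ring
    have h3 (x : RapidVec) : (recOp θ u ^ (j + 1)) x = recOp θ u ((recOp θ u ^ j) x) := by
      rw [← LinearEquiv.mul_apply, ← zpow_one_add, add_comm]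
    rw [h1, h2, h3, ← (recOp θ u).injective.eq_iff
      (a := lieProd F ((fieldOp θ ^ j) G) u), map_add, map_smul]
    push_cast
    rw [mul_add, mul_one, add_smul, add_comm ((c * (j : ℂ)) • _), add_assoc,
      add_right_inj]
  induction j using Int.induction_on with
  | zero => simp
  | succ j ih => exact (key j).2 ih
  | pred j ih => exact (key _).1 (by rwa [sub_add_cancel])

/-- The Lie products in the orbits of two commuting vector fields with respect to which the
recursion operator is homogeneous. -/
theorem lieProd_zpow_zpow {F G : Regular} {c d : ℂ}
    (hF : ∀ u h, lieOp θ F u h = c • recOp θ u h) (hG : ∀ u h, lieOp θ G u h = d • recOp θ u h)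
    (hFG : lieProd F G = 0) (i j : ℤ) :
    lieProd ((fieldOp θ ^ i) F) ((fieldOp θ ^ j) G) =
      ((c * j) • (fieldOp θ ^ (i + j)) G - (d * i) • (fieldOp θ ^ (i + j)) F : Regular).1 := by
  funext u
  have h1 := lieProd_zpow_right (lieOp_zpow hF i) G j u
  -- Only the second slot can be raised this way, so `[G, L^i F]` is computed as well and
  -- antisymmetry combines the two.
  have h2 := lieProd_zpow_right (i := 0) (F := G) (c := d) (by simpa using hG) F i u
  have hGF : lieProd G F = 0 := by rw [lieProd_swap, hFG, neg_zero]
  rw [h1, lieProd_swap _ G, Pi.neg_apply, h2, hGF]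
  simp only [Pi.zero_apply, map_zero, add_zero, zero_add, map_neg, map_smul]
  rw [← LinearEquiv.mul_apply, ← zpow_add, add_comm j i, ← sub_eq_add_neg]
  change _ = (c * j) • ((fieldOp θ ^ (i + j)) G).1 u - (d * i) • ((fieldOp θ ^ (i + j)) F).1 u
  rw [zpow_fieldOp_apply, zpow_fieldOp_apply]

end

section

open Filter Topology

/-! ### The seed flows -/

lemma Rapid.affine_mul {f : ℤ → ℂ} (hf : Rapid f) (α β : ℂ) :
    Rapid fun n => (α + β * (2 * (n : ℂ) + 1)) * f n := by
  have h : Rapid fun n => (n : ℂ) * f n := fun k => by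
    obtain ⟨C, hC⟩ := IsBig.const_zero_iff.1 (hf (k + 1))
    refine IsBig.const_zero_iff.2 ⟨C, fun n => le_trans ?_ (hC n)⟩
    have hw := weight_pos n
    rw [norm_mul, Complex.norm_intCast, pow_succ, mul_assoc]
    gcongr
    unfold weight
    linarith
  have h1 := (hf.smul (α + β)).add (h.smul (2 * β))
  convert h1 using 2
  ring

/-- The infinitesimal gauge transformation `h_n ↦ (α + β (2n+1)) (h_n¹, -h_n²)`. -/
def gauge (α β : ℂ) : RapidVec →ₗ[ℂ] RapidVec where
  toFun h := ⟨fun n => ((α + β * (2 * (n : ℂ) + 1)) * (h.1 n).1,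
    -((α + β * (2 * (n : ℂ) + 1)) * (h.1 n).2)),
    rapidDecay_iff.2 ⟨h.fst.affine_mul α β, (h.snd.affine_mul α β).neg⟩⟩
  map_add' h h' := by
    refine Subtype.ext (funext fun n => Prod.ext ?_ ?_)
    · exact mul_add _ _ _
    · change -(_ * ((h.1 n).2 + (h'.1 n).2)) = -(_ * _) + -(_ * _)
      ring
  map_smul' z h := by
    refine Subtype.ext (funext fun n => Prod.ext ?_ ?_)
    · exact mul_left_comm _ _ _
    · change -(_ * (z * (h.1 n).2)) = z * -(_ * _)
      ring

lemma gauge_fst (α β : ℂ) (h : RapidVec) (n : ℤ) :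
    ((gauge α β h).1 n).1 = (α + β * (2 * (n : ℂ) + 1)) * (h.1 n).1 := rfl

lemma gauge_snd (α β : ℂ) (h : RapidVec) (n : ℤ) :
    ((gauge α β h).1 n).2 = -((α + β * (2 * (n : ℂ) + 1)) * (h.1 n).2) := rfl

/-- The potential as a rapidly decreasing sequence. -/
def Phase.toRapid (u : Phase) : RapidVec := ⟨u.1, u.2.1⟩

lemma Phase.coe_toRapid (u : Phase) : u.toRapid.1 = u.1 := rfl

lemma isDer_gauge (α β : ℂ) (u : Phase) :
    IsDer (fun u => gauge α β u.toRapid) u (gauge α β) := fun v => by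
  have h1 (ε : ℝ) : (gauge α β (u.toRapid + (ε : ℂ) • v)).1 =
      fun n => (gauge α β u.toRapid).1 n + (ε : ℂ) • (gauge α β v).1 n := by
    rw [map_add, map_smul]
    rfl
  refine VecJet.congr (c := fun ε => (gauge α β (u.toRapid + (ε : ℂ) • v)).1) ?_ ?_
  · simp only [h1]
    exact ⟨fun k => Jet.line ((gauge α β u.toRapid).fst k) ((gauge α β v).fst k),
      fun k => Jet.line ((gauge α β u.toRapid).snd k) ((gauge α β v).snd k)⟩
  · filter_upwards [eventually_along u v] with ε ⟨w, hw', hw⟩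
    rw [hw]
    exact congrArg (fun x => (gauge α β x).1) (Subtype.ext hw'.symm)

/-- The vector field of an infinitesimal gauge transformation. -/
def seed (α β : ℂ) : Regular :=
  ⟨fun u => gauge α β u.toRapid, fun _ => gauge α β, isDer_gauge α β⟩

lemma der_seed (α β : ℂ) (u : Phase) : der (seed α β) u = gauge α β :=
  der_eq (F := seed α β) (isDer_gauge α β u)

/-- The seeds are linear in `u` and act as diagonal operators, which commute. -/
lemma lieProd_seed (α β α' β' : ℂ) : lieProd (seed α β) (seed α' β') = 0 := by
  funext u
  rw [lieProd_apply, der_seed, der_seed]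
  refine Subtype.ext (funext fun n => Prod.ext ?_ ?_)
  · change _ * (_ * _) - _ * (_ * _) = (0 : ℂ)
    ring
  · change -(_ * -(_ * _)) - -(_ * -(_ * _)) = (0 : ℂ)
    ring

/-- The factor `α + β (2n+1)` changes by `2β` per lattice step, and `L` moves the first component by
`E` and the second by `E⁻¹`; the constant `α` does not contribute. Thus `L` is invariant along
`K⁽⁰⁾` and homogeneous along `σ⁽⁰⁾`. -/
lemma lieOp_seed (θ α β : ℂ) (u : Phase) (h : RapidVec) :
    lieOp θ (seed α β) u h = (-2 * β) • recOp θ u h := by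
  -- The products `Q_n R_n` are gauge invariant, so this density cancels pointwise; the one in `hs`
  -- couples neighbouring sites and produces `2β`.
  have ht (n : ℤ) : invDiff θ (nonlocalDerArg u.1 (gauge α β u.toRapid).1 h.1) n +
      nonlocalGamma θ u.1 (gauge α β h).1 n = 0 := by
    have h1 := invDiff_add θ (rapid_nonlocalDerArg u (gauge α β u.toRapid) h).decay2
      (rapid_nonlocal_arg u (gauge α β h)).decay2
    refine (congrFun h1 n).symm.trans ?_
    have h2 : (fun n => nonlocalDerArg u.1 (gauge α β u.toRapid).1 h.1 n +
        ((u.1 n).2 * ((gauge α β h).1 n).1 + (u.1 n).1 * ((gauge α β h).1 n).2) /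
          gammaSq u.1 n) = fun _ => 0 := by
      funext n
      rw [nonlocalDerArg, Phase.gammaDer, gauge_fst, gauge_snd, gauge_fst, gauge_snd,
        div_eq_mul_inv]
      simp only [Phase.toRapid]
      ring
    rw [h2]
    simp [invDiff]
  have hs (n : ℤ) : invDiff θ (localDerArg (gauge α β u.toRapid).1 h.1) n +
      invDiff θ (fun n => (u.1 n).2 * ((gauge α β h).1 (n + 1)).1 +
        (u.1 n).1 * ((gauge α β h).1 (n - 1)).2) n = 2 * β *
      invDiff θ (fun n => (u.1 n).2 * (h.1 (n + 1)).1 + (u.1 n).1 * (h.1 (n - 1)).2) n := by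
    have h1 := invDiff_add θ (rapid_localDerArg (gauge α β u.toRapid) h).decay2
      (rapid_local_arg u (gauge α β h)).decay2
    refine (congrFun h1 n).symm.trans ?_
    rw [← congrFun (invDiff_smul θ (2 * β)) n]
    congr 1
    funext n
    rw [localDerArg, gauge_fst, gauge_snd, gauge_fst, gauge_snd]
    simp only [Phase.toRapid]
    push_cast
    ring
  have hγ (n : ℤ) : Phase.gammaDer u.1 (gauge α β u.toRapid).1 n = 0 := by
    rw [Phase.gammaDer, gauge_fst, gauge_snd]
    simp only [Phase.toRapid]
    ring
  rw [lieOp, der_seed]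
  refine Subtype.ext (funext fun n => Prod.ext ?_ ?_)
  · change ((gauge α β (recOp θ u h)).1 n).1 - (opL θ u.1 (gauge α β h).1 n).1 -
      (opLDer θ u.1 (gauge α β u.toRapid).1 h.1 n).1 = -2 * β * (opL θ u.1 h.1 n).1
    rw [gauge_fst, coe_recOp]
    simp only [opL, opLDer, hγ]
    rw [gauge_fst, gauge_fst, gauge_fst]
    simp only [Phase.coe_toRapid]
    push_cast
    linear_combination (u.1 n).1 * hs (n + 1) + gammaSq u.1 n * (u.1 (n + 1)).1 * ht (n + 1)
  · change ((gauge α β (recOp θ u h)).1 n).2 - (opL θ u.1 (gauge α β h).1 n).2 -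
      (opLDer θ u.1 (gauge α β u.toRapid).1 h.1 n).2 = -2 * β * (opL θ u.1 h.1 n).2
    rw [gauge_snd, coe_recOp]
    simp only [opL, opLDer, hγ]
    rw [gauge_snd, gauge_snd, gauge_snd]
    simp only [Phase.coe_toRapid]
    push_cast
    linear_combination -(u.1 n).2 * hs n - gammaSq u.1 n * (u.1 (n - 1)).2 * ht n

/-! ### Laurent polynomials in the recursion operator -/

open LaurentPolynomial

/-- The Laurent polynomials in the recursion operator, acting on regular vector fields. -/
def act (θ : ℂ) : ℂ[T;T⁻¹] →ₐ[ℂ] Module.End ℂ Regular :=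
  AddMonoidAlgebra.lift ℂ _ ℤ
    (LinearEquiv.automorphismGroup.toLinearMapMonoidHom.comp (zpowersHom _ (fieldOp θ)))

lemma act_T (θ : ℂ) (i : ℤ) (F : Regular) : act θ (T i) F = (fieldOp θ ^ i) F := by
  rw [act, T, AddMonoidAlgebra.lift_single, one_smul]
  rfl

/-- The derivation `T d/dT` as a linear map. -/
def eulerLin : ℂ[T;T⁻¹] →ₗ[ℂ] ℂ[T;T⁻¹] :=
  Finsupp.linearCombination ℂ (fun n : ℤ => (n : ℂ) • (T n : ℂ[T;T⁻¹])) ∘ₗ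
    (AddMonoidAlgebra.coeffLinearEquiv ℂ).toLinearMap

lemma eulerLin_T (n : ℤ) : eulerLin (T n) = (n : ℂ) • T n := by
  change Finsupp.linearCombination ℂ _ (Finsupp.single n 1) = _
  rw [Finsupp.linearCombination_single, one_smul]

lemma laurent_induction {P : ℂ[T;T⁻¹] → Prop} (hT : ∀ n, P (T n))
    (hadd : ∀ p q, P p → P q → P (p + q)) (hsmul : ∀ (z : ℂ) p, P p → P (z • p)) (p : ℂ[T;T⁻¹]) :
    P p :=
  LaurentPolynomial.induction_on' p hadd fun n a => by
    rw [← smul_eq_C_mul]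
    exact hsmul a _ (hT n)

/-- The derivation `T d/dT`. -/
def euler : Derivation ℂ ℂ[T;T⁻¹] ℂ[T;T⁻¹] :=
  Derivation.mk' eulerLin fun p q => by
    induction p using laurent_induction with
    | hT m =>
      induction q using laurent_induction with
      | hT n =>
        rw [← T_add, eulerLin_T, eulerLin_T, eulerLin_T]
        simp only [smul_eq_mul, mul_smul_comm, ← T_add]
        rw [add_comm n m, ← add_smul]
        push_cast
        rw [add_comm]
      | hadd p q hp hq =>
        rw [mul_add, map_add, map_add, hp, hq]
        simp only [smul_eq_mul]
        ring
      | hsmul z p hp =>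
        rw [mul_smul_comm, map_smul, map_smul, hp]
        simp only [smul_eq_mul, smul_add, mul_smul_comm, smul_mul_assoc]
    | hadd p q hp hq =>
      rw [add_mul, map_add, map_add, hp, hq]
      simp only [smul_eq_mul]
      ring
    | hsmul z p hp =>
      rw [smul_mul_assoc, map_smul, map_smul, hp]
      simp only [smul_eq_mul, smul_add, mul_smul_comm, smul_mul_assoc]

lemma euler_T (n : ℤ) : euler (T n) = (n : ℂ) • T n := eulerLin_T n

/-- Bilinear extension of `lieProd_zpow_zpow`: the exponents appearing there as factors are the
eigenvalues of `T d/dT` on monomials. -/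
theorem lieProd_act {θ : ℂ} {F G : Regular} {c d : ℂ}
    (hF : ∀ u h, lieOp θ F u h = c • recOp θ u h) (hG : ∀ u h, lieOp θ G u h = d • recOp θ u h)
    (hFG : lieProd F G = 0) (p q : ℂ[T;T⁻¹]) :
    lieProd (act θ p F) (act θ q G) =
      (c • act θ (p * euler q) G - d • act θ (euler p * q) F : Regular).1 := by
  induction p using laurent_induction with
  | hT i =>
    induction q using laurent_induction with
    | hT j =>
      rw [act_T, act_T, lieProd_zpow_zpow hF hG hFG, euler_T, euler_T, mul_smul_comm,
        smul_mul_assoc, ← T_add, map_smul, map_smul, LinearMap.smul_apply, LinearMap.smul_apply,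
        act_T, act_T, smul_smul, smul_smul]
    | hadd p q hp hq =>
      simp only [map_add, LinearMap.add_apply, mul_add, hp, hq, smul_add]
      rw [← Submodule.coe_add]
      congr 1
      abel
    | hsmul z p hp =>
      simp only [map_smul, LinearMap.smul_apply, mul_smul_comm, Derivation.map_smul, hp]
      rw [← Submodule.coe_smul]
      congr 1
      module
  | hadd p q hp hq =>
    simp only [map_add, LinearMap.add_apply, add_mul, hp, hq, smul_add]
    rw [← Submodule.coe_add]
    congr 1
    abel
  | hsmul z p hp =>
    simp only [map_smul, LinearMap.smul_apply, smul_mul_assoc, Derivation.map_smul, hp]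
    rw [← Submodule.coe_smul]
    congr 1
    module

/-- The vector field `p(L) K⁽⁰⁾`. -/
def isoField (θ : ℂ) : ℂ[T;T⁻¹] →ₗ[ℂ] Regular := (act θ).toLinearMap.flip (seed 1 0)

/-- The vector field `p(L) σ⁽⁰⁾`. -/
def nonisoField (θ : ℂ) : ℂ[T;T⁻¹] →ₗ[ℂ] Regular := (act θ).toLinearMap.flip (seed 0 1)

/-! ### Brackets of the two families of fields in terms of symbols -/

section Brackets

variable (θ : ℂ) (p q : ℂ[T;T⁻¹])

lemma lieProd_iso_iso : lieProd (isoField θ p) (isoField θ q) = 0 := by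
  refine (lieProd_act (lieOp_seed θ 1 0) (lieOp_seed θ 1 0) (lieProd_seed _ _ _ _) p q).trans ?_
  simp

lemma lieProd_iso_noniso :
    lieProd (isoField θ p) (nonisoField θ q) = (isoField θ (2 * (euler p * q))).1 := by
  refine (lieProd_act (lieOp_seed θ 1 0) (lieOp_seed θ 0 1) (lieProd_seed _ _ _ _) p q).trans
    (congrArg Subtype.val ?_)
  rw [two_mul, map_add]
  change (-2 * 0 : ℂ) • nonisoField θ _ - (-2 * 1 : ℂ) • isoField θ _ = _
  module

lemma lieProd_noniso_noniso : lieProd (nonisoField θ p) (nonisoField θ q) =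
    (nonisoField θ (2 * (euler p * q - p * euler q))).1 := by
  refine (lieProd_act (lieOp_seed θ 0 1) (lieOp_seed θ 0 1) (lieProd_seed _ _ _ _) p q).trans
    (congrArg Subtype.val ?_)
  rw [two_mul, map_add, map_sub]
  change (-2 * 1 : ℂ) • nonisoField θ _ - (-2 * 1 : ℂ) • nonisoField θ _ = _
  module

end Brackets

end

section

open LaurentPolynomial

/-! ### The flows -/

/-- The symbol of `𝓛 = L - 2 + L⁻¹`. -/
def symbolW : ℂ[T;T⁻¹] := T 1 - 2 + T (-1)

/-- The symbol of `L - L⁻¹`. -/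
def symbolV : ℂ[T;T⁻¹] := T 1 - T (-1)

/-- The constant `1/2`. -/
def half : ℂ[T;T⁻¹] := C (1 / 2)

lemma half_mul (p : ℂ[T;T⁻¹]) : half * p = (1 / 2 : ℂ) • p := (smul_eq_C_mul _ _).symm

lemma two_mul_half : 2 * half = 1 := by
  have : (2 : ℂ[T;T⁻¹]) = C 2 := (map_ofNat C 2).symm
  rw [half, this, ← map_mul]
  norm_num

lemma symbolV_sq : symbolV ^ 2 = symbolW ^ 2 + 4 * symbolW := by
  have : (T 1 * T (-1) : ℂ[T;T⁻¹]) = 1 := by rw [← T_add, add_neg_cancel, T_zero]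
  rw [symbolV, symbolW]
  linear_combination -4 * this

lemma euler_symbolW : euler symbolW = symbolV := by
  have h2 : euler (2 : ℂ[T;T⁻¹]) = 0 := euler.map_natCast 2
  rw [symbolW, symbolV, map_add, map_sub, h2, euler_T, euler_T]
  push_cast
  module

lemma euler_symbolV : euler symbolV = symbolW + 2 := by
  rw [symbolW, symbolV, map_sub, euler_T, euler_T]
  push_cast
  rw [neg_smul, one_smul, one_smul]
  ring

lemma euler_half_mul (p : ℂ[T;T⁻¹]) : euler (half * p) = half * euler p := by
  rw [half_mul, half_mul, Derivation.map_smul]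

lemma euler_pow_succ (m : ℕ) :
    euler (symbolW ^ (m + 1)) = (m + 1 : ℕ) * symbolW ^ m * symbolV := by
  rw [Derivation.leibniz_pow, euler_symbolW, Nat.add_sub_cancel, nsmul_eq_mul, smul_eq_mul,
    mul_assoc]

/-- Multiplying by `V` turns `m W^(m-1) V` into `m W^(m-1) V²`, a polynomial in `W`; this form needs
no exception at `m = 0`. -/
lemma euler_pow_mul_symbolV (m : ℕ) : euler (symbolW ^ m) * symbolV =
    m * (symbolW ^ (m + 1) + 4 * symbolW ^ m) := by
  cases m with
  | zero => simp
  | succ m =>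
    rw [euler_pow_succ]
    linear_combination ((m + 1 : ℕ) * symbolW ^ m : ℂ[T;T⁻¹]) * symbolV_sq

lemma euler_pow_mul_half_symbolV (m : ℕ) : euler (symbolW ^ m * (half * symbolV)) =
    half * ((m + 1) * symbolW ^ (m + 1) + 2 * (2 * m + 1) * symbolW ^ m) := by
  rw [Derivation.leibniz, euler_half_mul, euler_symbolV, smul_eq_mul, smul_eq_mul]
  linear_combination half * euler_pow_mul_symbolV m

/-- The symbols of the flows `𝓛ᵐ K⁽⁰⁾_[j]`. -/
def flowSymbol (j : Fin 2) (m : ℕ) : ℂ[T;T⁻¹] :=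
  symbolW ^ m * if j = 0 then 1 else half * symbolV

lemma flowSymbol_zero (m : ℕ) : flowSymbol 0 m = symbolW ^ m := by simp [flowSymbol]

lemma flowSymbol_one (m : ℕ) : flowSymbol 1 m = symbolW ^ m * (half * symbolV) := by
  simp [flowSymbol]

section Flows

variable (θ : ℂ)

/-- The value of a regular vector field as a lattice function. -/
def fieldOf : Regular →ₗ[ℂ] VectorField := toField ∘ₗ Regular.subtype

lemma fieldOf_act_T_one (F : Regular) (u : Phase) :
    fieldOf (act θ (T 1) F) u = opL θ u.1 (fieldOf F u) := by
  rw [act_T, zpow_one]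
  rfl

lemma fieldOf_act_T_neg_one (F : Regular) (u : Phase) :
    fieldOf (act θ (T (-1)) F) u = opLInv θ u.1 (fieldOf F u) := by
  rw [act_T, zpow_neg_one]
  rfl

lemma act_add_apply (p q : ℂ[T;T⁻¹]) (F : Regular) : act θ (p + q) F = act θ p F + act θ q F :=
  map_add ((act θ).toLinearMap.flip F) p q

lemma act_sub_apply (p q : ℂ[T;T⁻¹]) (F : Regular) : act θ (p - q) F = act θ p F - act θ q F :=
  map_sub ((act θ).toLinearMap.flip F) p q

lemma act_half_mul_apply (p : ℂ[T;T⁻¹]) (F : Regular) :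
    act θ (half * p) F = (1 / 2 : ℂ) • act θ p F := by
  rw [half_mul]
  exact map_smul ((act θ).toLinearMap.flip F) _ p

lemma fieldOf_act_symbolW (F : Regular) (u : Phase) :
    fieldOf (act θ symbolW F) u = opCalL θ u.1 (fieldOf F u) := by
  have h2 : act θ 2 F = (2 : ℂ) • F := by
    rw [map_ofNat, two_smul, ← one_add_one_eq_two]
    rfl
  rw [symbolW, act_add_apply, act_sub_apply, map_add fieldOf, map_sub fieldOf, h2,
    Pi.add_apply, Pi.sub_apply, fieldOf_act_T_one, fieldOf_act_T_neg_one, map_smul]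
  rfl

lemma fieldOf_act_symbolW_pow (m : ℕ) (F : Regular) (u : Phase) :
    fieldOf (act θ (symbolW ^ m) F) u = (opCalL θ u.1)^[m] (fieldOf F u) := by
  induction m with
  | zero => simp
  | succ m ih =>
    rw [pow_succ', map_mul, Module.End.mul_apply, fieldOf_act_symbolW, ih,
      Function.iterate_succ_apply']

lemma fieldOf_act_half_symbolV (F : Regular) (u : Phase) :
    fieldOf (act θ (half * symbolV) F) u =
      (1 / 2 : ℂ) • (opL θ u.1 (fieldOf F u) - opLInv θ u.1 (fieldOf F u)) := by
  rw [act_half_mul_apply, map_smul, symbolV, act_sub_apply, map_sub fieldOf, Pi.smul_apply, Pi.sub_apply, fieldOf_act_T_one,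
    fieldOf_act_T_neg_one]

lemma fieldOf_seed_iso (u : Phase) : fieldOf (seed 1 0) u = alK u.1 := by
  funext n
  change (((1 : ℂ) + 0 * _) * (u.1 n).1, -(((1 : ℂ) + 0 * _) * (u.1 n).2)) = _
  simp [alK]

lemma fieldOf_seed_noniso (u : Phase) : fieldOf (seed 0 1) u = alSigma u.1 := by
  funext n
  change (((0 : ℂ) + 1 * _) * (u.1 n).1, -(((0 : ℂ) + 1 * _) * (u.1 n).2)) = _
  simp [alSigma, alK]

lemma K_eq (j : Fin 2) (m : ℕ) : K θ j m = fieldOf (isoField θ (flowSymbol j m)) := by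
  funext u
  change _ = fieldOf (act θ _ (seed 1 0)) u
  rw [flowSymbol, map_mul, Module.End.mul_apply, fieldOf_act_symbolW_pow]
  unfold K K0
  split_ifs
  · rw [map_one, Module.End.one_apply, fieldOf_seed_iso]
  · rw [fieldOf_act_half_symbolV, fieldOf_seed_iso]

lemma sigma_eq (j : Fin 2) (m : ℕ) :
    sigma θ j m = fieldOf (nonisoField θ (half * flowSymbol j m)) := by
  funext u
  change _ = fieldOf (act θ _ (seed 0 1)) u
  rw [flowSymbol, mul_left_comm, map_mul, Module.End.mul_apply, fieldOf_act_symbolW_pow,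
    act_half_mul_apply, map_smul, Pi.smul_apply]
  unfold sigma sigma0
  split_ifs
  · rw [map_one, Module.End.one_apply, fieldOf_seed_noniso]
  · rw [fieldOf_act_half_symbolV, fieldOf_seed_noniso, smul_smul]
    norm_num

lemma bracket_fieldOf (F G : Regular) : bracket (fieldOf F) (fieldOf G) = toField (lieProd F G) :=
  bracket_toField F G

lemma bracket_iso_iso (p q : ℂ[T;T⁻¹]) :
    bracket (fieldOf (isoField θ p)) (fieldOf (isoField θ q)) = 0 := by
  rw [bracket_fieldOf, lieProd_iso_iso, map_zero]

lemma bracket_iso_noniso (p q : ℂ[T;T⁻¹]) :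
    bracket (fieldOf (isoField θ p)) (fieldOf (nonisoField θ q)) =
      fieldOf (isoField θ (2 * (euler p * q))) := by
  rw [bracket_fieldOf, lieProd_iso_noniso]
  rfl

lemma bracket_noniso_noniso (p q : ℂ[T;T⁻¹]) :
    bracket (fieldOf (nonisoField θ p)) (fieldOf (nonisoField θ q)) =
      fieldOf (nonisoField θ (2 * (euler p * q - p * euler q))) := by
  rw [bracket_fieldOf, lieProd_noniso_noniso]
  rfl

/-! ### The structure relations -/

lemma natCast_eq_C (m : ℕ) : (m : ℂ[T;T⁻¹]) = C (m : ℂ) := (map_natCast C m).symm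

lemma bracket_K_K (j k : Fin 2) (m s : ℕ) : bracket (K θ j m) (K θ k s) = 0 := by
  rw [K_eq, K_eq, bracket_iso_iso]

lemma bracket_K_zero_sigma_zero (m s : ℕ) : bracket (K θ 0 m) (sigma θ 0 s) =
    (2 * (m : ℂ)) • prev (K θ 1) (m + s) := by
  rw [K_eq, sigma_eq, bracket_iso_noniso, flowSymbol_zero, flowSymbol_zero]
  -- At `m = 0` the coefficient vanishes, so the index `-1` is harmless.
  cases m with
  | zero => simp
  | succ m =>
    rw [Nat.add_right_comm]
    change _ = _ • K θ 1 (m + s)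
    rw [K_eq, flowSymbol_one, ← map_smul, ← map_smul, euler_pow_succ, smul_eq_C_mul]
    refine congrArg (fun p => fieldOf (isoField θ p)) ?_
    rw [map_mul, map_ofNat, ← natCast_eq_C]
    ring

lemma bracket_K_zero_sigma_one (m s : ℕ) : bracket (K θ 0 m) (sigma θ 1 s) =
    ((1 / 2 : ℂ) * (m : ℂ)) • (K θ 0 (m + s + 1) + (4 : ℂ) • K θ 0 (m + s)) := by
  simp only [K_eq, sigma_eq, bracket_iso_noniso, flowSymbol_zero, flowSymbol_one]
  simp only [← map_smul, ← map_add, smul_eq_C_mul]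
  refine congrArg (fun p => fieldOf (isoField θ p)) ?_
  simp only [map_mul, map_ofNat, ← natCast_eq_C]
  change _ = half * _ * _
  linear_combination (2 * half * half * symbolW ^ s) * euler_pow_mul_symbolV m +
    (half * m * symbolW ^ s * (symbolW ^ (m + 1) + 4 * symbolW ^ m)) * two_mul_half

lemma bracket_K_one_sigma (j : Fin 2) (m s : ℕ) : bracket (K θ 1 m) (sigma θ j s) =
    (1 / 2 : ℂ) • (((m : ℂ) + 1) • K θ j (m + s + 1) +
      (2 * (2 * (m : ℂ) + 1)) • K θ j (m + s)) := by
  simp only [K_eq, sigma_eq, bracket_iso_noniso, flowSymbol_one, euler_pow_mul_half_symbolV]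
  simp only [← map_smul, ← map_add, smul_eq_C_mul]
  refine congrArg (fun p => fieldOf (isoField θ p)) ?_
  simp only [map_add, map_mul, map_ofNat, map_one, ← natCast_eq_C, flowSymbol]
  change _ = half * _
  linear_combination (half * ((m + 1) * symbolW ^ (m + 1) + 2 * (2 * m + 1) * symbolW ^ m) *
    symbolW ^ s * if j = 0 then 1 else half * symbolV) * two_mul_half

lemma bracket_sigma_zero_sigma_zero (m s : ℕ) : bracket (sigma θ 0 m) (sigma θ 0 s) =
    (2 * ((m : ℂ) - (s : ℂ))) • prev (sigma θ 1) (m + s) := by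
  simp only [sigma_eq, bracket_noniso_noniso, flowSymbol_zero, euler_half_mul]
  rcases Nat.eq_zero_or_pos (m + s) with h | h
  · obtain ⟨rfl, rfl⟩ := Nat.add_eq_zero_iff.1 h
    simp
  obtain ⟨l, hl⟩ := Nat.exists_eq_add_of_le' h
  -- Here `l = m + s - 1`; the excluded case `m = s = 0` has coefficient zero.
  have key : euler (symbolW ^ m) * symbolW ^ s - symbolW ^ m * euler (symbolW ^ s) =
      (m - s) * (symbolW ^ l * symbolV) := by
    cases m with
    | zero =>
      obtain rfl : s = l + 1 := by omega
      rw [euler_pow_succ, pow_zero, Derivation.map_one_eq_zero]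
      push_cast
      ring
    | succ m =>
      obtain rfl : l = m + s := by omega
      cases s with
      | zero => rw [euler_pow_succ]; simp; ring
      | succ s => rw [euler_pow_succ, euler_pow_succ]; push_cast; ring
  rw [hl]
  change _ = _ • sigma θ 1 l
  rw [sigma_eq, flowSymbol_one, ← map_smul, ← map_smul, smul_eq_C_mul]
  refine congrArg (fun p => fieldOf (nonisoField θ p)) ?_
  rw [map_mul, map_sub, map_ofNat, ← natCast_eq_C, ← natCast_eq_C]
  linear_combination 2 * half * half * key

lemma bracket_sigma_sigma_one (j : Fin 2) (m s : ℕ) : bracket (sigma θ j m) (sigma θ 1 s) =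
    (1 / 2 : ℂ) • (((m : ℂ) - (s : ℂ) - 1 + ((j : ℕ) : ℂ)) • sigma θ j (m + s + 1) +
      (2 * (2 * (m : ℂ) - 2 * (s : ℂ) - 1 + ((j : ℕ) : ℂ))) • sigma θ j (m + s)) := by
  simp only [sigma_eq, bracket_noniso_noniso, flowSymbol_one, euler_half_mul,
    euler_pow_mul_half_symbolV, ← map_smul, ← map_add, smul_eq_C_mul]
  refine congrArg (fun p => fieldOf (nonisoField θ p)) ?_
  simp only [map_add, map_sub, map_mul, map_ofNat, map_one, ← natCast_eq_C]
  change _ = half * _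
  fin_cases j
  · simp only [Fin.zero_eta, flowSymbol_zero, Nat.cast_zero]
    linear_combination (2 * half ^ 3 * symbolW ^ s) * euler_pow_mul_symbolV m +
      half ^ 2 * ((m - s - 1) * symbolW ^ (m + s + 1) +
        2 * (2 * m - 2 * s - 1) * symbolW ^ (m + s)) * two_mul_half
  · simp only [Fin.mk_one, flowSymbol_one, Nat.cast_one,
      euler_pow_mul_half_symbolV]
    linear_combination half ^ 3 * symbolV * ((m - s) * symbolW ^ (m + s + 1) +
        4 * (m - s) * symbolW ^ (m + s)) * two_mul_half

/-! ### The Lie algebra -/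

/-- Every element of `𝒟` has a pair of symbols; uniqueness is not needed. This gives
differentiability on `𝒟` and reduces the Jacobi identity to polynomials. -/
lemma exists_of_mem_algD {f : VectorField} (hf : f ∈ algD θ) :
    ∃ p q : ℂ[T;T⁻¹], f = fieldOf (isoField θ p + nonisoField θ q) := by
  induction hf using Submodule.span_induction with
  | mem f hf =>
    rcases hf with ⟨j, m, rfl⟩ | ⟨j, m, rfl⟩
    · exact ⟨flowSymbol j m, 0, by rw [K_eq, map_zero, add_zero]⟩
    · exact ⟨0, half * flowSymbol j m, by rw [sigma_eq, map_zero, zero_add]⟩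
  | zero => exact ⟨0, 0, by simp⟩
  | add f g _ _ hf hg =>
    obtain ⟨p, q, rfl⟩ := hf
    obtain ⟨p', q', rfl⟩ := hg
    refine ⟨p + p', q + q', ?_⟩
    rw [← map_add, map_add (isoField θ), map_add (nonisoField θ)]
    congr 1
    abel
  | smul z f _ hf =>
    obtain ⟨p, q, rfl⟩ := hf
    exact ⟨z • p, z • q, by rw [map_smul (isoField θ), map_smul (nonisoField θ), ← smul_add,
      map_smul]⟩

lemma exists_regular_of_mem_algD {f : VectorField} (hf : f ∈ algD θ) :
    ∃ F : Regular, f = fieldOf F := by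
  obtain ⟨p, q, rfl⟩ := exists_of_mem_algD θ hf
  exact ⟨_, rfl⟩

lemma bracket_swap (f g : VectorField) : bracket f g = -bracket g f := (neg_sub _ _).symm

/-! ### Bilinearity and closure of the bracket on `𝒟` -/

section Linearity

variable {θ} {f g h : VectorField}

lemma bracket_add_left (hf : f ∈ algD θ) (hg : g ∈ algD θ) (hh : h ∈ algD θ) :
    bracket (f + g) h = bracket f h + bracket g h := by
  obtain ⟨F, rfl⟩ := exists_regular_of_mem_algD θ hf
  obtain ⟨G, rfl⟩ := exists_regular_of_mem_algD θ hg
  obtain ⟨H, rfl⟩ := exists_regular_of_mem_algD θ hh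
  rw [← map_add, bracket_fieldOf, bracket_fieldOf, bracket_fieldOf, map_add lieProd,
    LinearMap.add_apply, map_add]

lemma bracket_smul_left (z : ℂ) (hf : f ∈ algD θ) (hg : g ∈ algD θ) :
    bracket (z • f) g = z • bracket f g := by
  obtain ⟨F, rfl⟩ := exists_regular_of_mem_algD θ hf
  obtain ⟨G, rfl⟩ := exists_regular_of_mem_algD θ hg
  rw [← map_smul, bracket_fieldOf, bracket_fieldOf, map_smul lieProd, LinearMap.smul_apply,
    map_smul]

lemma bracket_add_right (hf : f ∈ algD θ) (hg : g ∈ algD θ) (hh : h ∈ algD θ) :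
    bracket f (g + h) = bracket f g + bracket f h := by
  rw [bracket_swap, bracket_add_left hg hh hf, neg_add, ← bracket_swap, ← bracket_swap]

lemma bracket_smul_right (z : ℂ) (hf : f ∈ algD θ) (hg : g ∈ algD θ) :
    bracket f (z • g) = z • bracket f g := by
  rw [bracket_swap, bracket_smul_left z hg hf, ← smul_neg, ← bracket_swap]

lemma K_mem_algD (j : Fin 2) (m : ℕ) : K θ j m ∈ algD θ :=
  Submodule.subset_span (Or.inl ⟨j, m, rfl⟩)

lemma sigma_mem_algD (j : Fin 2) (m : ℕ) : sigma θ j m ∈ algD θ :=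
  Submodule.subset_span (Or.inr ⟨j, m, rfl⟩)

lemma prev_mem_algD {F : ℕ → VectorField} (hF : ∀ m, F m ∈ algD θ) (l : ℕ) :
    prev F l ∈ algD θ := by
  cases l with
  | zero => exact zero_mem _
  | succ l => exact hF l

lemma bracket_K_sigma_mem (j k : Fin 2) (m s : ℕ) :
    bracket (K θ j m) (sigma θ k s) ∈ algD θ := by
  have hK (j : Fin 2) (m : ℕ) : K θ j m ∈ algD θ := K_mem_algD j m
  match j, k with
  | 0, 0 =>
    rw [bracket_K_zero_sigma_zero]
    exact Submodule.smul_mem _ _ (prev_mem_algD (hK 1) _)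
  | 0, 1 =>
    rw [bracket_K_zero_sigma_one]
    exact Submodule.smul_mem _ _ (add_mem (hK _ _) (Submodule.smul_mem _ _ (hK _ _)))
  | 1, k =>
    rw [bracket_K_one_sigma]
    exact Submodule.smul_mem _ _ (add_mem (Submodule.smul_mem _ _ (hK _ _))
      (Submodule.smul_mem _ _ (hK _ _)))

lemma bracket_sigma_sigma_mem (j k : Fin 2) (m s : ℕ) :
    bracket (sigma θ j m) (sigma θ k s) ∈ algD θ := by
  have hS (j : Fin 2) (m : ℕ) : sigma θ j m ∈ algD θ := sigma_mem_algD j m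
  have h1 (j : Fin 2) (m s : ℕ) : bracket (sigma θ j m) (sigma θ 1 s) ∈ algD θ := by
    rw [bracket_sigma_sigma_one]
    exact Submodule.smul_mem _ _ (add_mem (Submodule.smul_mem _ _ (hS _ _))
      (Submodule.smul_mem _ _ (hS _ _)))
  match j, k with
  | 0, 0 =>
    rw [bracket_sigma_zero_sigma_zero]
    exact Submodule.smul_mem _ _ (prev_mem_algD (hS 1) _)
  | 0, 1 => exact h1 0 m s
  | 1, 1 => exact h1 1 m s
  | 1, 0 =>
    rw [bracket_swap]
    exact neg_mem (h1 0 s m)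

lemma bracket_mem_algD (hf : f ∈ algD θ) (hg : g ∈ algD θ) : bracket f g ∈ algD θ := by
  have hzl {g : VectorField} (hg : g ∈ algD θ) : bracket 0 g ∈ algD θ := by
    have := bracket_smul_left 0 (zero_mem (algD θ)) hg
    rw [zero_smul, zero_smul] at this
    rw [this]
    exact zero_mem _
  have hzr {g : VectorField} (hg : g ∈ algD θ) : bracket g 0 ∈ algD θ := by
    rw [bracket_swap]
    exact neg_mem (hzl hg)
  induction hf using Submodule.span_induction with
  | zero => exact hzl hg
  | add f f' hf hf' h1 h2 =>
    rw [bracket_add_left hf hf' hg]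
    exact add_mem h1 h2
  | smul z f hf h1 =>
    rw [bracket_smul_left z hf hg]
    exact Submodule.smul_mem _ _ h1
  | mem f hf =>
    have hfD : f ∈ algD θ := Submodule.subset_span hf
    induction hg using Submodule.span_induction with
    | zero => exact hzr hfD
    | add g g' hg hg' h1 h2 =>
      rw [bracket_add_right hfD hg hg']
      exact add_mem h1 h2
    | smul z g hg h1 =>
      rw [bracket_smul_right z hfD hg]
      exact Submodule.smul_mem _ _ h1
    | mem g hg =>
      rcases hf with ⟨j, m, rfl⟩ | ⟨j, m, rfl⟩ <;> rcases hg with ⟨k, s, rfl⟩ | ⟨k, s, rfl⟩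
      · rw [bracket_K_K]
        exact zero_mem _
      · exact bracket_K_sigma_mem j k m s
      · rw [bracket_swap]
        exact neg_mem (bracket_K_sigma_mem k j s m)
      · exact bracket_sigma_sigma_mem j k m s

end Linearity

/-- The Lie product on `𝒟`. -/
def algBracket : algD θ →ₗ[ℂ] algD θ →ₗ[ℂ] algD θ :=
  LinearMap.mk₂ ℂ (fun f g => ⟨bracket f.1 g.1, bracket_mem_algD f.2 g.2⟩)
    (fun f g h => Subtype.ext (bracket_add_left f.2 g.2 h.2))
    (fun z f g => Subtype.ext (bracket_smul_left z f.2 g.2))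
    (fun f g h => Subtype.ext (bracket_add_right f.2 g.2 h.2))
    (fun z f g => Subtype.ext (bracket_smul_right z f.2 g.2))

/-- On symbols this is a semidirect product: `q` acts as the vector field `2 q T d/dT`, up to sign,
on the abelian part formed by `p`. -/
lemma bracket_pair (p q p' q' : ℂ[T;T⁻¹]) :
    bracket (fieldOf (isoField θ p + nonisoField θ q))
      (fieldOf (isoField θ p' + nonisoField θ q')) =
    fieldOf (isoField θ (2 * (euler p * q' - euler p' * q)) +
      nonisoField θ (2 * (euler q * q' - q * euler q'))) := by
  rw [bracket_fieldOf]
  have hF (F : Regular) : toField F.1 = fieldOf F := rfl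
  simp only [map_add, LinearMap.add_apply, lieProd_iso_iso, lieProd_iso_noniso,
    lieProd_noniso_noniso, lieProd_swap (nonisoField θ q) (isoField θ p'), hF, map_neg, map_zero,
    mul_sub, map_sub]
  abel

/-- Both components of the cyclic sum are differential polynomials in the symbols that cancel by the
Leibniz rule alone. -/
lemma bracket_jacobi {f g h : VectorField} (hf : f ∈ algD θ) (hg : g ∈ algD θ)
    (hh : h ∈ algD θ) :
    bracket f (bracket g h) + bracket g (bracket h f) + bracket h (bracket f g) = 0 := by
  obtain ⟨p, q, rfl⟩ := exists_of_mem_algD θ hf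
  obtain ⟨p', q', rfl⟩ := exists_of_mem_algD θ hg
  obtain ⟨p'', q'', rfl⟩ := exists_of_mem_algD θ hh
  simp only [bracket_pair]
  have hadd (a b a' b' : ℂ[T;T⁻¹]) : fieldOf (isoField θ a + nonisoField θ b) +
      fieldOf (isoField θ a' + nonisoField θ b') =
        fieldOf (isoField θ (a + a') + nonisoField θ (b + b')) := by
    rw [← map_add fieldOf, add_add_add_comm, map_add (isoField θ), map_add (nonisoField θ)]
  rw [hadd, hadd]
  have h2 : euler (2 : ℂ[T;T⁻¹]) = 0 := euler.map_natCast 2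
  have hz (a b : ℂ[T;T⁻¹]) (ha : a = 0) (hb : b = 0) :
      fieldOf (isoField θ a + nonisoField θ b) = 0 := by simp [ha, hb]
  refine hz _ _ ?_ ?_ <;>
  · simp only [Derivation.leibniz, map_sub, smul_eq_mul, h2]
    ring

end Flows

end

end

end DAKNS

theorem mainTheorem1 (θ : ℂ) :
    -- `L` and `L⁻¹` are mutually inverse operators on rapidly decreasing functions
    (∀ (u : DAKNS.Phase) (h : DAKNS.Vec), DAKNS.RapidDecay h →
      DAKNS.RapidDecay (DAKNS.opL θ u.1 h) ∧ DAKNS.RapidDecay (DAKNS.opLInv θ u.1 h) ∧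
      DAKNS.opL θ u.1 (DAKNS.opLInv θ u.1 h) = h ∧
      DAKNS.opLInv θ u.1 (DAKNS.opL θ u.1 h) = h) ∧
    -- the elements of `𝒟` have rapidly decreasing values, and their Gateaux derivatives exist
    (∀ f ∈ DAKNS.algD θ, ∀ u : DAKNS.Phase, DAKNS.RapidDecay (f u)) ∧
    (∀ f ∈ DAKNS.algD θ, ∀ g ∈ DAKNS.algD θ, ∀ (u : DAKNS.Phase) (n : ℤ),
      DifferentiableAt ℝ (DAKNS.alongLine f u (g u) n) 0) ∧
    -- `𝒟` is a complex Lie algebra under the Lie product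
    (∃ B : DAKNS.algD θ →ₗ[ℂ] DAKNS.algD θ →ₗ[ℂ] DAKNS.algD θ,
      (∀ f g : DAKNS.algD θ,
        (B f g : DAKNS.VectorField) =
          DAKNS.bracket (f : DAKNS.VectorField) (g : DAKNS.VectorField)) ∧
      (∀ f : DAKNS.algD θ, B f f = 0) ∧
      (∀ f g h : DAKNS.algD θ, B f (B g h) + B g (B h f) + B h (B f g) = 0)) ∧
    -- the structure relations
    (∀ (j k : Fin 2) (m s : ℕ), DAKNS.bracket (DAKNS.K θ j m) (DAKNS.K θ k s) = 0) ∧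
    (∀ m s : ℕ, DAKNS.bracket (DAKNS.K θ 0 m) (DAKNS.sigma θ 0 s) =
      (2 * (m : ℂ)) • DAKNS.prev (DAKNS.K θ 1) (m + s)) ∧
    (∀ m s : ℕ, DAKNS.bracket (DAKNS.K θ 0 m) (DAKNS.sigma θ 1 s) =
      ((1 / 2 : ℂ) * (m : ℂ)) •
        (DAKNS.K θ 0 (m + s + 1) + (4 : ℂ) • DAKNS.K θ 0 (m + s))) ∧
    (∀ (j : Fin 2) (m s : ℕ), DAKNS.bracket (DAKNS.K θ 1 m) (DAKNS.sigma θ j s) =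
      (1 / 2 : ℂ) •
        (((m : ℂ) + 1) • DAKNS.K θ j (m + s + 1) +
          (2 * (2 * (m : ℂ) + 1)) • DAKNS.K θ j (m + s))) ∧
    (∀ m s : ℕ, DAKNS.bracket (DAKNS.sigma θ 0 m) (DAKNS.sigma θ 0 s) =
      (2 * ((m : ℂ) - (s : ℂ))) • DAKNS.prev (DAKNS.sigma θ 1) (m + s)) ∧
    (∀ (j : Fin 2) (m s : ℕ), DAKNS.bracket (DAKNS.sigma θ j m) (DAKNS.sigma θ 1 s) =
      (1 / 2 : ℂ) •
        (((m : ℂ) - (s : ℂ) - 1 + ((j : ℕ) : ℂ)) • DAKNS.sigma θ j (m + s + 1) +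
          (2 * (2 * (m : ℂ) - 2 * (s : ℂ) - 1 + ((j : ℕ) : ℂ))) •
            DAKNS.sigma θ j (m + s))) := by
  refine ⟨fun u h hh => ?_, fun f hf u => ?_, fun f hf g hg u n => ?_,
    ⟨DAKNS.algBracket θ, fun f g => rfl, fun f => Subtype.ext (sub_self _), fun f g h =>
      Subtype.ext (DAKNS.bracket_jacobi θ f.2 g.2 h.2)⟩,
    DAKNS.bracket_K_K θ, DAKNS.bracket_K_zero_sigma_zero θ, DAKNS.bracket_K_zero_sigma_one θ,
    DAKNS.bracket_K_one_sigma θ, DAKNS.bracket_sigma_zero_sigma_zero θ,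
    DAKNS.bracket_sigma_sigma_one θ⟩
  · exact ⟨DAKNS.rapidDecay_opL θ u ⟨h, hh⟩, DAKNS.rapidDecay_opLInv θ u ⟨h, hh⟩,
      DAKNS.opL_opLInv θ u ⟨h, hh⟩, DAKNS.opLInv_opL θ u ⟨h, hh⟩⟩
  · obtain ⟨F, rfl⟩ := DAKNS.exists_regular_of_mem_algD θ hf
    exact (F.1 u).2
  · obtain ⟨F, rfl⟩ := DAKNS.exists_regular_of_mem_algD θ hf
    obtain ⟨G, rfl⟩ := DAKNS.exists_regular_of_mem_algD θ hg
    exact (DAKNS.hasDerivAt_alongLine F G u n).differentiableAt
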